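/- **Setting.** Let $b\ge 2$ be an integer and $\mathbf a=(a_1,a_2,\dots)$ a sequence of integers with $1\le a_1\le a_2\le\cdots$ and $a_n\to\infty$. The bubble graph $X=X_{\mathbf a,b}$ has as vertices the pairs $(w,u)$, where $w$ is a finite word in the letters $1,\dots,b-1$ and $u\in\mathbb Z/2a_{|w|+1}\mathbb Z$; the vertex $(w,u)$ is at level $|w|+1$ and the root is $o=(\emptyset,0)$. Let $\alpha$ be the permutation $(w,u)\mapsto(w,u+1)$ of the vertices (rotation of the bubbles), and let $\beta$ be the permutation that rotates every branching cycle, $(w,a_{|w|+1})\mapsto(w1,0)\mapsto(w2,0)\mapsto\cdots\mapsto(w(b-1),0)\mapsto(w,a_{|w|+1})$, and fixes all other vertices. The edges of $X$ join $x$ to $\alpha x$ and to $\beta x$; $B_X(o,r)$ is the ball of radius $r$ about $o$ for the graph distance, and $X^m$ is the set of vertices of level at most $m$. The bubble group is $\Gamma=\langle\alpha,\beta\rangle$ and $G=\mathbb Z\wr_X\Gamma=(\bigoplus_X\mathbb Z)\rtimes\Gamma$, with $(f,g)(f',g')=(f+g\cdot f',gg')$ and $(g\cdot f)(x)=f(g^{-1}x)$.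 For a symmetric probability measure $\phi$ on $G$ and $v\in\mathbb R$ put $$\Lambda_{1,\phi}(v)=\inf\Big\{\tfrac12\sum_{x,y}|f(yx)-f(x)|\phi(y):\ |\mathrm{supp} f|\le v,\ \|f\|_1=1\Big\},$$ $$\Lambda_{2,\phi}(v)=\inf_{|\Omega|\le v}\ \inf\Big\{\tfrac12\sum_{x,y}|f(yx)-f(x)|^2\phi(y):\ \mathrm{supp} f\subset\Omega,\ \|f\|_2=1\Big\},$$ with real-valued $f$ and $\inf\emptyset=+\infty$. Let $k(r)=\min\{k\ge1: a_k>2r\}$ and $N(r)=|X^{k(r)-1}|+(b-1)^{k(r)}r/2$, and write $t!$ for $\lfloor t\rfloor!$ when $t\ge 0$ is real. **Theorem.** Let $\phi$ be any finitely supported symmetric probability measure on $G$ whose support generates $G$. There is a constant $C>0$ (depending on $\mathbf a$, $b$, $\phi$) such that for all real $r>1$: 1. $\Lambda_{1,\phi}(v)\ge \dfrac1{Cr}$ for all $v\le C^{-1}r^{|B_X(o,r)|/C}$; 2. $\Lambda_{2,\phi}(v)\le \dfrac C{r^2}$ for all $v\ge C\,\big(|X^{k(r)-1}|+(b-1)^{k(r)}r/2\big)!$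 if $b\ge3$, and for all $v\ge C\,(C\,N(r))!$ if $b=2$. Moreover the bounds match for suitable $\mathbf a$: if $b=3$ and $a_k=\lfloor 2^{sk}\rfloor$ for all $k\ge 1$, with $s>0$ real, then for every such $\phi$ there are $C>0$ and $v_0$ such that, for $v\ge v_0$, both $\Lambda_{1,\phi}(v)^2$ and $\Lambda_{2,\phi}(v)$ lie between $C^{-1}\psi(v)$ and $C\psi(v)$, where $\psi(v)=\Big(\dfrac{\log\log v}{\log v}\Big)^{2s/(s+1)}$. -/

import Mathlib

open scoped ENNReal

/-! ### The bubble graph and the bubble group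

`a k` is the scaling sequence `a_1, a_2, …` (the value `a 0` is never used); the branching sequence is
constant, equal to `b`. -/

/-- Words labelling the bubbles, i.e. vertices of the rooted tree in which every vertex has `b - 1`
children. The element `i` of `Fin (b - 1)` stands for the letter `i + 1` of `{1, …, b - 1}`.
The *last* letter of the word is the head of the list, so `z :: w` is the child `w z` of `w`. -/
abbrev BubbleWord (b : ℕ) : Type := List (Fin (b - 1))

/-- The vertices `(w, u)` of the bubble graph: a word `w` with `|w| = k` and a position `u` on the
cycle of length `2 a_{k+1}` attached to `w`. -/
abbrev BubbleVertex (a : ℕ → ℕ+) (b : ℕ) : Type :=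
  Σ w : BubbleWord b, ZMod (2 * (a (w.length + 1) : ℕ))

/-- The level of the vertex `(w, u)` is `|w| + 1`. -/
def bubbleLevel {a : ℕ → ℕ+} {b : ℕ} (x : BubbleVertex a b) : ℕ := x.1.length + 1

/-- The root `o` of the bubble graph. -/
def bubbleRoot (a : ℕ → ℕ+) (b : ℕ) : BubbleVertex a b := ⟨[], 0⟩

/-- The far end `(w, a_{|w|+1})` of the bubble of `w`; this is the vertex, closest to the root, of
the branching cycle `(w, a_{|w|+1}), (w 1, 0), …, (w (b-1), 0)`. -/
def bubbleEnd (a : ℕ → ℕ+) {b : ℕ} (w : BubbleWord b) : BubbleVertex a b :=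
  ⟨w, ((a (w.length + 1) : ℕ) : ZMod (2 * (a (w.length + 1) : ℕ)))⟩

/-- The origin `(w, 0)` of the bubble of `w`. -/
def bubbleStart (a : ℕ → ℕ+) {b : ℕ} (w : BubbleWord b) : BubbleVertex a b := ⟨w, 0⟩

theorem bubbleEnd_ne_bubbleStart (a : ℕ → ℕ+) {b : ℕ} (w w' : BubbleWord b) :
    bubbleEnd a w ≠ bubbleStart a w' := by
  intro h
  obtain rfl : w = w' := congrArg Sigma.fst h
  have h2 := eq_of_heq (Sigma.mk.inj h).2
  rw [ZMod.natCast_eq_zero_iff] at h2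
  have := Nat.le_of_dvd (a (w.length + 1)).pos h2
  have := (a (w.length + 1)).pos
  omega

/-- The rotation `α` of all bubbles: `(w, u) ↦ (w, u + 1)`. -/
def bubbleAlpha (a : ℕ → ℕ+) (b : ℕ) : Equiv.Perm (BubbleVertex a b) :=
  Equiv.sigmaCongrRight fun _ => Equiv.addRight 1

/-- One step forward along the branching cycles:
`(w, a_{|w|+1}) ↦ (w 1, 0) ↦ (w 2, 0) ↦ … ↦ (w (b-1), 0) ↦ (w, a_{|w|+1})`;
all other vertices, and the root, are fixed. -/
def bubbleBetaFun (a : ℕ → ℕ+) (b : ℕ) (x : BubbleVertex a b) : BubbleVertex a b :=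
  if x = bubbleEnd a x.1 then
    if h : 0 < b - 1 then bubbleStart a (⟨0, h⟩ :: x.1) else x
  else if x = bubbleStart a x.1 then
    match x.1 with
    | [] => x
    | z :: w =>
      if h : z.1 + 1 < b - 1 then bubbleStart a (⟨z.1 + 1, h⟩ :: w) else bubbleEnd a w
  else x

/-- One step backward along the branching cycles. -/
def bubbleBetaInv (a : ℕ → ℕ+) (b : ℕ) (x : BubbleVertex a b) : BubbleVertex a b :=
  if x = bubbleEnd a x.1 then
    if h : 0 < b - 1 then bubbleStart a (⟨b - 1 - 1, by omega⟩ :: x.1) else x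
  else if x = bubbleStart a x.1 then
    match x.1 with
    | [] => x
    | z :: w =>
      if 0 < z.1 then bubbleStart a (⟨z.1 - 1, by omega⟩ :: w) else bubbleEnd a w
  else x

theorem bubbleBetaFun_end (a : ℕ → ℕ+) {b : ℕ} (w : BubbleWord b) :
    bubbleBetaFun a b (bubbleEnd a w) =
      if h : 0 < b - 1 then bubbleStart a (⟨0, h⟩ :: w) else bubbleEnd a w := by
  rw [bubbleBetaFun, if_pos (by rfl)]
  rfl

theorem bubbleBetaFun_start_nil (a : ℕ → ℕ+) (b : ℕ) :
    bubbleBetaFun a b (bubbleStart a []) = bubbleStart a [] := by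
  have := bubbleEnd_ne_bubbleStart a ([] : BubbleWord b) []
  rw [bubbleBetaFun, if_neg (by exact this.symm), if_pos (by rfl)]
  rfl

theorem bubbleBetaFun_start_cons (a : ℕ → ℕ+) {b : ℕ} (z : Fin (b - 1)) (w : BubbleWord b) :
    bubbleBetaFun a b (bubbleStart a (z :: w)) =
      if h : z.1 + 1 < b - 1 then bubbleStart a (⟨z.1 + 1, h⟩ :: w) else bubbleEnd a w := by
  have := bubbleEnd_ne_bubbleStart a (z :: w) (z :: w)
  rw [bubbleBetaFun, if_neg (by exact this.symm), if_pos (by rfl)]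
  rfl

theorem bubbleBetaFun_of_ne (a : ℕ → ℕ+) {b : ℕ} (x : BubbleVertex a b)
    (h₁ : x ≠ bubbleEnd a x.1) (h₂ : x ≠ bubbleStart a x.1) : bubbleBetaFun a b x = x := by
  simp [bubbleBetaFun, h₁, h₂]

theorem bubbleBetaInv_end (a : ℕ → ℕ+) {b : ℕ} (w : BubbleWord b) :
    bubbleBetaInv a b (bubbleEnd a w) =
      if h : 0 < b - 1 then bubbleStart a (⟨b - 1 - 1, by omega⟩ :: w) else bubbleEnd a w := by
  rw [bubbleBetaInv, if_pos (by rfl)]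
  rfl

theorem bubbleBetaInv_start_nil (a : ℕ → ℕ+) (b : ℕ) :
    bubbleBetaInv a b (bubbleStart a []) = bubbleStart a [] := by
  have := bubbleEnd_ne_bubbleStart a ([] : BubbleWord b) []
  rw [bubbleBetaInv, if_neg (by exact this.symm), if_pos (by rfl)]
  rfl

theorem bubbleBetaInv_start_cons (a : ℕ → ℕ+) {b : ℕ} (z : Fin (b - 1)) (w : BubbleWord b) :
    bubbleBetaInv a b (bubbleStart a (z :: w)) =
      if 0 < z.1 then bubbleStart a (⟨z.1 - 1, by omega⟩ :: w) else bubbleEnd a w := by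
  have := bubbleEnd_ne_bubbleStart a (z :: w) (z :: w)
  rw [bubbleBetaInv, if_neg (by exact this.symm), if_pos (by rfl)]
  rfl

theorem bubbleBetaInv_of_ne (a : ℕ → ℕ+) {b : ℕ} (x : BubbleVertex a b)
    (h₁ : x ≠ bubbleEnd a x.1) (h₂ : x ≠ bubbleStart a x.1) : bubbleBetaInv a b x = x := by
  simp [bubbleBetaInv, h₁, h₂]

/-- The rotation `β` of all branching cycles. -/
def bubbleBeta (a : ℕ → ℕ+) (b : ℕ) : Equiv.Perm (BubbleVertex a b) where
  toFun := bubbleBetaFun a b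
  invFun := bubbleBetaInv a b
  left_inv x := by
    by_cases h₁ : x = bubbleEnd a x.1
    · rw [h₁, bubbleBetaFun_end]
      split_ifs with h
      · rw [bubbleBetaInv_start_cons]; simp
      · rw [bubbleBetaInv_end, dif_neg h]
    by_cases h₂ : x = bubbleStart a x.1
    · obtain ⟨w, u⟩ := x
      rw [h₂]
      cases w with
      | nil => rw [bubbleBetaFun_start_nil, bubbleBetaInv_start_nil]
      | cons z w =>
        rw [bubbleBetaFun_start_cons]
        split_ifs with h
        · rw [bubbleBetaInv_start_cons]; simp
        · have hz : b - 1 - 1 = z.1 := by omega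
          rw [bubbleBetaInv_end, dif_pos (by omega)]
          simp [hz]
    · rw [bubbleBetaFun_of_ne a x h₁ h₂, bubbleBetaInv_of_ne a x h₁ h₂]
  right_inv x := by
    by_cases h₁ : x = bubbleEnd a x.1
    · rw [h₁, bubbleBetaInv_end]
      split_ifs with h
      · rw [bubbleBetaFun_start_cons, dif_neg (by simp only; omega)]
      · rw [bubbleBetaFun_end, dif_neg h]
    by_cases h₂ : x = bubbleStart a x.1
    · obtain ⟨w, u⟩ := x
      rw [h₂]
      cases w with
      | nil => rw [bubbleBetaInv_start_nil, bubbleBetaFun_start_nil]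
      | cons z w =>
        rw [bubbleBetaInv_start_cons]
        split_ifs with h
        · have hz : z.1 - 1 + 1 = z.1 := by omega
          rw [bubbleBetaFun_start_cons, dif_pos (by simp only; omega)]
          simp [hz]
        · have hz : z.1 = 0 := by omega
          rw [bubbleBetaFun_end, dif_pos (by omega)]
          congr 2
          exact Fin.ext hz.symm
    · rw [bubbleBetaInv_of_ne a x h₁ h₂, bubbleBetaFun_of_ne a x h₁ h₂]

/-- The bubble group `Γ`: the group of permutations of the vertices of the bubble graph generated by
`α` and `β`. -/
def bubbleGroup (a : ℕ → ℕ+) (b : ℕ) : Subgroup (Equiv.Perm (BubbleVertex a b)) :=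
  Subgroup.closure {bubbleAlpha a b, bubbleBeta a b}

/-- The bubble graph `X` (orientations, labels, loops and multiplicities of edges forgotten). -/
def bubbleGraph (a : ℕ → ℕ+) (b : ℕ) : SimpleGraph (BubbleVertex a b) :=
  SimpleGraph.fromRel fun x y => y = bubbleAlpha a b x ∨ y = bubbleBeta a b x

/-- The ball `B_X(o, r)` for the graph distance of the bubble graph. -/
def bubbleBall (a : ℕ → ℕ+) (b : ℕ) (r : ℝ) : Set (BubbleVertex a b) :=
  {x | ∃ p : (bubbleGraph a b).Walk (bubbleRoot a b) x, (p.length : ℝ) ≤ r}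

/-- `X^m`: the vertices of the first `m` levels of the bubble graph. -/
def bubbleLevels (a : ℕ → ℕ+) (b m : ℕ) : Set (BubbleVertex a b) :=
  {x | bubbleLevel x ≤ m}

/-- `k(r) = min {k ≥ 1 : a_k > 2 r}`. -/
noncomputable def bubbleIndex (a : ℕ → ℕ+) (r : ℝ) : ℕ :=
  sInf {k : ℕ | 1 ≤ k ∧ 2 * r < ((a k : ℕ) : ℝ)}

/-- The scaling sequence `1 ≤ a_1 ≤ a_2 ≤ …` increases to infinity. -/
structure IsScalingSequence (a : ℕ → ℕ+) : Prop where
  mono : ∀ j k : ℕ, 1 ≤ j → j ≤ k → a j ≤ a k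
  tendsto : Filter.Tendsto (fun k => (a k : ℕ)) Filter.atTop Filter.atTop

/-! ### Permutational wreath products -/

/-- Permutations of `X` act on finitely supported functions by `(σ · f) x = f (σ⁻¹ x)`. -/
noncomputable def lampAut (X : Type*) : Equiv.Perm X →* MulAut (Multiplicative (X →₀ ℤ)) where
  toFun σ := AddEquiv.toMultiplicative (Finsupp.domCongr σ)
  map_one' := by ext f; rfl
  map_mul' σ τ := by ext f; rfl

/-- The permutational wreath product `ℤ ≀_X Γ = (⨁_X ℤ) ⋊ Γ` of a permutation group `Γ` of `X`, with
product `(f, g) (f', g') = (f + g · f', g g')`. -/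
abbrev ZWreath {X : Type*} (Γ : Subgroup (Equiv.Perm X)) : Type _ :=
  Multiplicative (X →₀ ℤ) ⋊[(lampAut X).comp Γ.subtype] Γ

/-! ### Isoperimetric profiles -/

/-- A finitely supported symmetric probability measure whose support generates the group. -/
structure IsSymmetricGenerating {G : Type*} [Group G] (φ : PMF G) : Prop where
  symm : ∀ x, φ x⁻¹ = φ x
  finite_support : φ.support.Finite
  closure_support : Subgroup.closure φ.support = ⊤

/-- `½ ∑_{x,y} |f (y x) - f x| ^ p φ(y)`; the Dirichlet form of `φ` for `p = 2`. -/
noncomputable def walkEnergy {G : Type*} [Group G] (φ : PMF G) (p : ℕ) (f : G →₀ ℝ) : ℝ≥0∞ :=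
  2⁻¹ * ∑' x, ∑' y, ENNReal.ofReal (|f (y * x) - f x| ^ p) * φ y

/-- The `L¹`-isoperimetric profile
`Λ_{1,φ}(v) = inf {½ ∑_{x,y} |f (y x) - f x| φ(y) : |supp f| ≤ v, ‖f‖₁ = 1}`
(the infimum of the empty set is `∞`). -/
noncomputable def profileOne {G : Type*} [Group G] (φ : PMF G) (v : ℝ) : ℝ≥0∞ :=
  ⨅ (f : G →₀ ℝ) (_ : (f.support.card : ℝ) ≤ v) (_ : ∑ x ∈ f.support, |f x| = 1),
    walkEnergy φ 1 f

/-- The lowest Dirichlet eigenvalue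
`λ_φ(Ω) = inf {½ ∑_{x,y} |f (y x) - f x|² φ(y) : supp f ⊆ Ω, ‖f‖₂ = 1}` of a finite set `Ω`. -/
noncomputable def dirichletEigenvalue {G : Type*} [Group G] (φ : PMF G) (Ω : Finset G) : ℝ≥0∞ :=
  ⨅ (f : G →₀ ℝ) (_ : f.support ⊆ Ω) (_ : ∑ x ∈ f.support, f x ^ 2 = 1), walkEnergy φ 2 f

/-- The `L²`-isoperimetric profile `Λ_{2,φ}(v) = inf {λ_φ(Ω) : |Ω| ≤ v}`. -/
noncomputable def profileTwo {G : Type*} [Group G] (φ : PMF G) (v : ℝ) : ℝ≥0∞ :=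
  ⨅ (Ω : Finset G) (_ : (Ω.card : ℝ) ≤ v), dirichletEigenvalue φ Ω

/-- The quantity `|X^{k(r)-1}| + (b-1)^{k(r)} r / 2`. -/
noncomputable def bubbleSize (a : ℕ → ℕ+) (b : ℕ) (r : ℝ) : ℝ :=
  ((bubbleLevels a b (bubbleIndex a r - 1)).ncard : ℝ)
    + ((b : ℝ) - 1) ^ bubbleIndex a r * r / 2

/-- The rate `(log log v / log v)^{2s/(s+1)}`. -/
noncomputable def logLogRate (s v : ℝ) : ℝ :=
  (Real.log (Real.log v) / Real.log v) ^ (2 * s / (s + 1))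

/-! Everything is expressed through the displacements `∑ |f (g x) - f x| ^ p` of a function `f`
under left multiplication by `g`. They are subadditive in `g` (up to a factor 2 when `p = 2`), so
the energy of `φ` controls, and is controlled by, the displacements of finitely many group elements.

Lower bound for the `L¹`-profile. The lamp at a vertex `x` of the ball of radius `r` is the lamp at
the root conjugated by an element of `Γ` whose displacement is at most `r` times that of a
generator. Hence changing it by any `j ≤ J`, with `J` of order `r`, costs `O(r)` times the energy.
These moves at the `n` vertices of the ball act on configurations as in `ℤ^n`, where a
Loomis–Whitney inequality (`sum_log_card_fibre_le`) shows that a set of at most `J ^ (n / 4)` points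
loses a fixed proportion under an average move. The coarea formula (`mul_sum_le_sum_posPart`) passes
from sets to functions, so the energy is at least of order `1 / r`.

Upper bound for the `L²`-profile. With `R` the integer part of `r`, let `H` be generated by the
conjugates `α ^ (-A) β α ^ A`, `|A| < R`. Beyond level `k(r)` branching cycles are so far apart that
each vertex meets at most one of them within rotation distance `R`; there `H` only records one
exponent modulo `b` for each `A`. Nearer the root it permutes a finite core, so `H` is finite
(`card_bubbleLocalGroup_le`). Write elements as `α ^ A h f` with `h` in `H` and lamps `f` on the
core. The test function is a product of tents in `A` and in the lamps, constant in `h`. Left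
multiplication by `α` shifts `A`, by `β` changes only `h`, and by the root lamp shifts one
coordinate of `f`, so the Rayleigh quotient is `O(1 / r²)`. Counting the support gives the
factorial.

For `b ≥ 3` the size grows at least linearly under dilation of `r`, up to a constant, so a constant
inside the factorial is removed by shrinking `r`. For exponential scaling both the ball and the size
have order `r ^ (1 + 1 / s)`; inverting the volume conditions at `r` of order `(log v / log log v) ^
(s / (s + 1))` gives the same rate twice, and Cheeger's inequality (`profileOne_sq_le`) transfers
each bound to the other profile. -/

/-! ### Displacements -/

/-- `∑_x |f (g x) - f x| ^ p`. -/
noncomputable def displacement {G : Type*} [Group G] (p : ℕ) (f : G → ℝ) (g : G) : ℝ≥0∞ :=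
  ∑' x, ENNReal.ofReal (|f (g * x) - f x| ^ p)

theorem tsum_ofReal_sq_eq_one {α : Type*} {f : α →₀ ℝ} (hf : ∑ x ∈ f.support, f x ^ 2 = 1) :
    ∑' x, ENNReal.ofReal (f x ^ 2) = 1 := by
  rw [tsum_eq_sum (s := f.support), ← ENNReal.ofReal_sum_of_nonneg fun _ _ => sq_nonneg _, hf,
    ENNReal.ofReal_one]
  intro x hx
  rw [Finsupp.notMem_support_iff.1 hx]; simp

section Displacement

variable {G : Type*} [Group G]

theorem walkEnergy_eq_tsum_displacement (φ : PMF G) (p : ℕ) (f : G →₀ ℝ) :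
    walkEnergy φ p f = 2⁻¹ * ∑' y, displacement p f y * φ y := by
  unfold walkEnergy displacement
  rw [ENNReal.tsum_comm]
  simp_rw [ENNReal.tsum_mul_right]

theorem displacement_one (p : ℕ) (hp : p ≠ 0) (f : G → ℝ) : displacement p f 1 = 0 := by
  simp [displacement, hp]

theorem displacement_inv (p : ℕ) (f : G → ℝ) (g : G) :
    displacement p f g⁻¹ = displacement p f g := by
  unfold displacement
  rw [← (Equiv.mulLeft g).tsum_eq]
  refine tsum_congr fun x => ?_
  simp [abs_sub_comm]

theorem tsum_displacement_shift (p : ℕ) (f : G → ℝ) (g h : G) :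
    ∑' x, ENNReal.ofReal (|f (g * h * x) - f (h * x)| ^ p) = displacement p f g := by
  unfold displacement
  rw [← (Equiv.mulLeft h).tsum_eq (fun x => ENNReal.ofReal (|f (g * x) - f x| ^ p))]
  refine tsum_congr fun x => ?_
  simp [mul_assoc]

theorem displacement_one_mul_le (f : G → ℝ) (g h : G) :
    displacement 1 f (g * h) ≤ displacement 1 f g + displacement 1 f h := by
  rw [← tsum_displacement_shift 1 f g h]
  unfold displacement
  rw [← ENNReal.tsum_add]
  refine ENNReal.tsum_le_tsum fun x => ?_
  rw [← ENNReal.ofReal_add (by positivity) (by positivity)]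
  apply ENNReal.ofReal_le_ofReal
  simp only [pow_one]
  exact abs_sub_le _ _ _

theorem displacement_two_mul_le (f : G → ℝ) (g h : G) :
    displacement 2 f (g * h) ≤ 2 * (displacement 2 f g + displacement 2 f h) := by
  rw [← tsum_displacement_shift 2 f g h]
  unfold displacement
  rw [← ENNReal.tsum_add, ← ENNReal.tsum_mul_left]
  refine ENNReal.tsum_le_tsum fun x => ?_
  rw [← ENNReal.ofReal_add (by positivity) (by positivity),
    show (2 : ℝ≥0∞) = ENNReal.ofReal 2 by simp, ← ENNReal.ofReal_mul (by norm_num)]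
  apply ENNReal.ofReal_le_ofReal
  simp only [sq_abs]
  nlinarith [sq_nonneg ((f (g * h * x) - f (h * x)) - (f (h * x) - f x))]

theorem displacement_one_pow_le (f : G → ℝ) (g : G) (n : ℕ) :
    displacement 1 f (g ^ n) ≤ n * displacement 1 f g := by
  induction n with
  | zero => simp [displacement_one]
  | succ n ih =>
    rw [pow_succ]
    refine (displacement_one_mul_le f _ _).trans ?_
    push_cast
    rw [add_mul, one_mul]
    gcongr

theorem displacement_mul_le_walkEnergy (φ : PMF G) (p : ℕ) (f : G →₀ ℝ) (y : G) :
    displacement p f y * φ y ≤ 2 * walkEnergy φ p f := by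
  rw [walkEnergy_eq_tsum_displacement, ← mul_assoc,
    ENNReal.mul_inv_cancel two_ne_zero ENNReal.ofNat_ne_top, one_mul]
  exact ENNReal.le_tsum y

/-- The displacement of a group element in `L¹` is controlled by the energy of any generating
measure. -/
theorem exists_displacement_one_le_walkEnergy {φ : PMF G} (hφ : IsSymmetricGenerating φ) (g : G) :
    ∃ K : ℝ, 0 ≤ K ∧ ∀ f : G →₀ ℝ, displacement 1 f g ≤ ENNReal.ofReal K * walkEnergy φ 1 f := by
  have hg : g ∈ Subgroup.closure φ.support := by rw [hφ.closure_support]; trivial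
  induction hg using Subgroup.closure_induction with
  | mem y hy =>
    have hy0 : φ y ≠ 0 := (PMF.mem_support_iff _ _).1 hy
    have hyt : φ y ≠ ⊤ := PMF.apply_ne_top φ y
    refine ⟨(2 / φ y).toReal, ENNReal.toReal_nonneg, fun f => ?_⟩
    rw [ENNReal.ofReal_toReal (ENNReal.div_ne_top ENNReal.ofNat_ne_top hy0)]
    have h := displacement_mul_le_walkEnergy φ 1 f y
    rw [← ENNReal.le_div_iff_mul_le (Or.inl hy0) (Or.inl hyt)] at h
    refine h.trans (le_of_eq ?_)
    rw [ENNReal.div_eq_inv_mul, ENNReal.div_eq_inv_mul, mul_assoc]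
  | one => exact ⟨0, le_rfl, fun f => by simp [displacement_one]⟩
  | mul x y _ _ hx hy =>
    obtain ⟨K, hK, h⟩ := hx
    obtain ⟨L, hL, h'⟩ := hy
    refine ⟨K + L, by positivity, fun f => (displacement_one_mul_le f x y).trans ?_⟩
    rw [ENNReal.ofReal_add hK hL, add_mul]
    exact add_le_add (h f) (h' f)
  | inv x _ hx =>
    obtain ⟨K, hK, h⟩ := hx
    exact ⟨K, hK, fun f => by rw [displacement_inv]; exact h f⟩

theorem exists_displacement_two_le {S : Finset G} (hS : Subgroup.closure (S : Set G) = ⊤) (g : G) :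
    ∃ K : ℝ, 0 ≤ K ∧ ∀ f : G → ℝ,
      displacement 2 f g ≤ ENNReal.ofReal K * ∑ s ∈ S, displacement 2 f s := by
  have hg : g ∈ Subgroup.closure (S : Set G) := by rw [hS]; trivial
  induction hg using Subgroup.closure_induction with
  | mem y hy =>
    refine ⟨1, zero_le_one, fun f => ?_⟩
    rw [ENNReal.ofReal_one, one_mul]
    exact Finset.single_le_sum (f := fun s => displacement 2 f s) (fun _ _ => zero_le) hy
  | one => exact ⟨0, le_rfl, fun f => by simp [displacement_one]⟩
  | mul x y _ _ hx hy =>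
    obtain ⟨K, hK, h⟩ := hx
    obtain ⟨L, hL, h'⟩ := hy
    refine ⟨2 * (K + L), by positivity, fun f => (displacement_two_mul_le f x y).trans ?_⟩
    rw [ENNReal.ofReal_mul zero_le_two, ENNReal.ofReal_add hK hL, mul_assoc, add_mul,
      ENNReal.ofReal_ofNat]
    gcongr
    · exact h f
    · exact h' f
  | inv x _ hx =>
    obtain ⟨K, hK, h⟩ := hx
    exact ⟨K, hK, fun f => by rw [displacement_inv]; exact h f⟩

/-- The energy of a finitely supported measure is controlled by the displacements of the elements
of any generating set. -/
theorem exists_walkEnergy_two_le {φ : PMF G} (hφ : φ.support.Finite) {S : Finset G}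
    (hS : Subgroup.closure (S : Set G) = ⊤) :
    ∃ K : ℝ, 0 ≤ K ∧ ∀ f : G →₀ ℝ,
      walkEnergy φ 2 f ≤ ENNReal.ofReal K * ∑ s ∈ S, displacement 2 f s := by
  choose K hK h using fun g => exists_displacement_two_le hS g
  refine ⟨∑ y ∈ hφ.toFinset, K y, Finset.sum_nonneg fun y _ => hK y, fun f => ?_⟩
  rw [walkEnergy_eq_tsum_displacement, tsum_eq_sum (s := hφ.toFinset)]
  · rw [ENNReal.ofReal_sum_of_nonneg fun y _ => hK y, Finset.sum_mul]
    refine (mul_le_of_le_one_left zero_le (by simp)).trans ?_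
    refine Finset.sum_le_sum fun y _ => ?_
    exact (mul_le_of_le_one_right zero_le (PMF.coe_le_one φ y)).trans (h y f)
  · intro y hy
    have : φ y = 0 := by
      rw [PMF.apply_eq_zero_iff]; simpa using hy
    simp [this]

/-! ### Test functions for the profiles, and Cheeger's inequality. -/

theorem walkEnergy_smul (φ : PMF G) (p : ℕ) (c : ℝ) (f : G →₀ ℝ) :
    walkEnergy φ p (c • f) = ENNReal.ofReal (|c| ^ p) * walkEnergy φ p f := by
  have h : ∀ y, displacement p (c • f : G →₀ ℝ) y = ENNReal.ofReal (|c| ^ p) * displacement p f y := by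
    intro y
    unfold displacement
    rw [← ENNReal.tsum_mul_left]
    refine tsum_congr fun x => ?_
    rw [← ENNReal.ofReal_mul (by positivity), ← mul_pow, ← abs_mul]
    simp [mul_sub]
  simp_rw [walkEnergy_eq_tsum_displacement, h, mul_assoc, ENNReal.tsum_mul_left]
  rw [mul_left_comm]

theorem profileTwo_le_of_walkEnergy_le {φ : PMF G} {v ε : ℝ} {f : G →₀ ℝ}
    (hv : (f.support.card : ℝ) ≤ v) (hf : f ≠ 0)
    (h : walkEnergy φ 2 f ≤ ENNReal.ofReal (ε * ∑ x ∈ f.support, f x ^ 2)) :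
    profileTwo φ v ≤ ENNReal.ofReal ε := by
  set m := ∑ x ∈ f.support, f x ^ 2 with hm
  have hm0 : 0 < m := by
    refine Finset.sum_pos (fun x hx => ?_) (Finsupp.support_nonempty_iff.2 hf)
    have := Finsupp.mem_support_iff.1 hx
    positivity
  have hs : 0 < Real.sqrt m := Real.sqrt_pos.2 hm0
  have hc : (Real.sqrt m)⁻¹ ≠ 0 := by positivity
  have hsupp : ((Real.sqrt m)⁻¹ • f).support = f.support := Finsupp.support_smul_eq hc
  have hsq : (Real.sqrt m)⁻¹ ^ 2 = m⁻¹ := by rw [inv_pow, Real.sq_sqrt hm0.le]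
  refine (iInf₂_le f.support hv).trans ((iInf₂_le ((Real.sqrt m)⁻¹ • f) hsupp.le).trans
    ((iInf_le _ ?_).trans ?_))
  · rw [hsupp]
    simp only [Finsupp.smul_apply, smul_eq_mul, mul_pow, hsq, ← Finset.mul_sum]
    exact inv_mul_cancel₀ hm0.ne'
  · rw [walkEnergy_smul, sq_abs, hsq]
    refine (mul_le_mul_right h _).trans ?_
    rw [← ENNReal.ofReal_mul (by positivity)]
    apply ENNReal.ofReal_le_ofReal
    field_simp
    exact le_rfl

open Classical in
theorem walkEnergy_two_single_le_one (φ : PMF G) :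
    walkEnergy φ 2 (Finsupp.single 1 1) ≤ 1 := by
  rw [walkEnergy_eq_tsum_displacement]
  have h : ∀ y : G, displacement 2 (Finsupp.single (1 : G) (1 : ℝ)) y ≤ 2 := by
    intro y
    unfold displacement
    calc _ ≤ ∑' x : G, ((if x = y⁻¹ then (1 : ℝ≥0∞) else 0) + if x = 1 then 1 else 0) := by
          refine ENNReal.tsum_le_tsum fun x => ?_
          have hyx : (1 = y * x) ↔ x = y⁻¹ := by
            rw [eq_comm, mul_eq_one_iff_eq_inv']
          simp only [Finsupp.single_apply, hyx, eq_comm (a := (1 : G)) (b := x)]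
          split_ifs <;> simp
      _ = 2 := by
          rw [ENNReal.tsum_add, tsum_ite_eq, tsum_ite_eq]; norm_num
  calc 2⁻¹ * ∑' y, displacement 2 (Finsupp.single (1 : G) (1 : ℝ)) y * φ y
      ≤ 2⁻¹ * ∑' y, 2 * φ y := by
        gcongr with y
        exact h y
    _ = 1 := by
        rw [ENNReal.tsum_mul_left, φ.tsum_coe, mul_one]
        exact ENNReal.inv_mul_cancel two_ne_zero ENNReal.ofNat_ne_top

/-- The point mass at the identity is a test function. This trivial bound covers the bounded range
of radii left over when `r` is rescaled below. -/
theorem profileTwo_le_one (φ : PMF G) {v : ℝ} (hv : 1 ≤ v) : profileTwo φ v ≤ 1 := by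
  have hsupp : (Finsupp.single (1 : G) (1 : ℝ)).support = {1} :=
    by simp
  refine (iInf₂_le {1} (by simpa using hv)).trans ((iInf₂_le (Finsupp.single 1 1) hsupp.le).trans
    ((iInf_le _ ?_).trans (walkEnergy_two_single_le_one φ)))
  rw [hsupp]; simp

/-- Factor `A² - B² = (A - B)(A + B)` and apply the weighted arithmetic–geometric inequality with
weight `t`; the terms in `A + B` sum to a multiple of the squared norm, which is 1. This is
Cheeger's argument with the optimisation in `t` postponed. -/
theorem walkEnergy_one_sq_le (φ : PMF G) {f : G →₀ ℝ} (hf : ∑ x ∈ f.support, f x ^ 2 = 1)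
    {t : ℝ} (ht : 0 < t) (q : G →₀ ℝ) (hq : ∀ x, q x = f x ^ 2) :
    walkEnergy φ 1 q ≤ ENNReal.ofReal (t / 2) * walkEnergy φ 2 f + ENNReal.ofReal t⁻¹ := by
  rw [walkEnergy_eq_tsum_displacement, walkEnergy_eq_tsum_displacement]
  have key : ∀ y, displacement 1 q y ≤
      ENNReal.ofReal (t / 2) * displacement 2 f y + 2 * ENNReal.ofReal t⁻¹ := by
    intro y
    have h1 : ∑' x, ENNReal.ofReal (f (y * x) ^ 2) = 1 := by
      rw [← tsum_ofReal_sq_eq_one hf, ← (Equiv.mulLeft y).tsum_eq (fun x => ENNReal.ofReal (f x ^ 2))]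
      rfl
    have h2 : (2 : ℝ≥0∞) * ENNReal.ofReal t⁻¹ =
        ∑' x, ENNReal.ofReal t⁻¹ * (ENNReal.ofReal (f (y * x) ^ 2) + ENNReal.ofReal (f x ^ 2)) := by
      rw [ENNReal.tsum_mul_left, ENNReal.tsum_add, h1, tsum_ofReal_sq_eq_one hf, mul_comm]
      norm_num
    rw [h2]
    unfold displacement
    rw [← ENNReal.tsum_mul_left, ← ENNReal.tsum_add]
    refine ENNReal.tsum_le_tsum fun x => ?_
    rw [← ENNReal.ofReal_add (by positivity) (by positivity), ← ENNReal.ofReal_mul (by positivity),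
      ← ENNReal.ofReal_mul (by positivity), ← ENNReal.ofReal_add (by positivity) (by positivity)]
    apply ENNReal.ofReal_le_ofReal
    rw [hq, hq, pow_one, sq_abs]
    generalize f (y * x) = A
    generalize f x = B
    have e : A ^ 2 - B ^ 2 = (A - B) * (A + B) := by ring
    rw [e, abs_mul]
    have h3 : (0 : ℝ) ≤ (t * |A - B| - |A + B|) ^ 2 := sq_nonneg _
    have h4 : |A - B| ^ 2 = (A - B) ^ 2 := sq_abs _
    have h5 : |A + B| ^ 2 = (A + B) ^ 2 := sq_abs _
    have h6 : t * (t / 2 * (A - B) ^ 2 + t⁻¹ * (A ^ 2 + B ^ 2)) =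
        t ^ 2 / 2 * (A - B) ^ 2 + (A ^ 2 + B ^ 2) := by field_simp
    refine le_of_mul_le_mul_left ?_ ht
    rw [h6]
    nlinarith [sq_nonneg (A - B)]
  calc 2⁻¹ * ∑' y, displacement 1 q y * φ y
      ≤ 2⁻¹ * ∑' y, (ENNReal.ofReal (t / 2) * displacement 2 f y + 2 * ENNReal.ofReal t⁻¹) * φ y := by
        gcongr with y
        exact key y
    _ = _ := by
        simp_rw [add_mul, ENNReal.tsum_add, mul_assoc, ENNReal.tsum_mul_left, φ.tsum_coe, mul_one,
          mul_add]
        rw [← mul_assoc 2⁻¹ 2, ENNReal.inv_mul_cancel two_ne_zero ENNReal.ofNat_ne_top, one_mul,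
          mul_left_comm]

/-- Cheeger's inequality `Λ₁² ≤ 2 Λ₂`. -/
theorem profileOne_sq_le (φ : PMF G) (v : ℝ) : profileOne φ v ^ 2 ≤ 2 * profileTwo φ v := by
  have main : ∀ f : G →₀ ℝ, (f.support.card : ℝ) ≤ v → ∑ x ∈ f.support, f x ^ 2 = 1 →
      profileOne φ v ^ 2 ≤ 2 * walkEnergy φ 2 f := by
    intro f hv hf
    set q : G →₀ ℝ := f.mapRange (fun t => t ^ 2) (by simp) with hqdef
    have hq : ∀ x, q x = f x ^ 2 := fun x => by simp [hqdef]
    have hsupp : q.support = f.support := by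
      ext x; simp [hq]
    have hle : profileOne φ v ≤ walkEnergy φ 1 q := by
      refine (iInf₂_le q (by rw [hsupp]; exact hv)).trans (iInf_le _ ?_)
      rw [hsupp, ← hf]
      exact Finset.sum_congr rfl fun x _ => by rw [hq, abs_of_nonneg (sq_nonneg _)]
    by_cases htop : walkEnergy φ 2 f = ⊤
    · rw [htop]; simp
    -- A finite bound `c` strictly above twice the energy is positive, so the optimal weight `t = 2
    -- / √c` makes sense even if the energy vanishes.
    refine le_of_forall_gt_imp_ge_of_dense fun c hc => ?_
    by_cases hct : c = ⊤
    · rw [hct]; exact le_top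
    have hc0 : 0 < c.toReal := ENNReal.toReal_pos (ne_bot_of_gt hc) hct
    set e := c.toReal with he
    have hs : 0 < Real.sqrt e := Real.sqrt_pos.2 hc0
    have hss : Real.sqrt e * Real.sqrt e = e := Real.mul_self_sqrt hc0.le
    have hE : walkEnergy φ 2 f ≤ ENNReal.ofReal (e / 2) := by
      rw [ENNReal.ofReal_div_of_pos two_pos, he, ENNReal.ofReal_toReal hct, ENNReal.ofReal_ofNat]
      rw [ENNReal.le_div_iff_mul_le (Or.inl two_ne_zero) (Or.inl ENNReal.ofNat_ne_top), mul_comm]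
      exact hc.le
    have h1 := hle.trans (walkEnergy_one_sq_le φ hf (t := 2 / Real.sqrt e) (by positivity) q hq)
    have h2 : profileOne φ v ≤ ENNReal.ofReal (Real.sqrt e) := by
      refine h1.trans ((add_le_add_left (mul_le_mul_right hE _) _).trans ?_)
      rw [← ENNReal.ofReal_mul (by positivity), ← ENNReal.ofReal_add (by positivity) (by positivity)]
      apply ENNReal.ofReal_le_ofReal
      have : e / Real.sqrt e = Real.sqrt e := by rw [div_eq_iff hs.ne']; exact hss.symm
      rw [inv_div, show 2 / Real.sqrt e / 2 * (e / 2) = (e / Real.sqrt e) / 2 by ring, this]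
      linarith
    calc profileOne φ v ^ 2 ≤ ENNReal.ofReal (Real.sqrt e) ^ 2 := by gcongr
      _ = c := by
        rw [← ENNReal.ofReal_pow hs.le, pow_two, hss, he, ENNReal.ofReal_toReal hct]
  unfold profileTwo dirichletEigenvalue
  simp_rw [ENNReal.mul_iInf_of_ne two_ne_zero ENNReal.ofNat_ne_top]
  refine le_iInf₂ fun Ω hΩ => le_iInf₂ fun f hf => le_iInf fun h => main f ?_ h
  exact le_trans (by exact_mod_cast Finset.card_le_card hf) hΩ

end Displacement

/-! ### Isoperimetry of products of lines -/

open Classical in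
/-- Loomis–Whitney inequality in entropy form: `R x` is the relation of lying on the same line in
direction `x`, and `π x` is the coordinate along these lines. -/
theorem sum_log_card_fibre_le {T ι κ : Type*} {R : ι → T → T → Prop} (hR : ∀ x, Equivalence (R x))
    {π : ι → T → κ} (hinj : ∀ x s t, R x s t → π x s = π x t → s = t)
    (hconst : ∀ x y s t, x ≠ y → R y s t → π x s = π x t) (B : Finset ι) (Ω : Finset T) :
    ∑ x ∈ B, ∑ s ∈ Ω, Real.log (Ω.filter (R x s)).card ≤ Ω.card * Real.log Ω.card := by
  induction B using Finset.induction_on generalizing Ω with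
  | empty =>
    simp only [Finset.sum_empty]
    exact mul_nonneg (Nat.cast_nonneg _) (Real.log_natCast_nonneg _)
  | insert x B hx ih =>
    rcases Ω.eq_empty_or_nonempty with rfl | hΩ
    · simp
    have hpos : (0 : ℝ) < Ω.card := by exact_mod_cast hΩ.card_pos
    set S : T → Finset T := fun s => Ω.filter fun t => π x t = π x s with hS
    -- Directions other than `x` preserve the coordinate `π x`, so the induction hypothesis applies
    -- inside each slice of constant `π x`.
    have hB : ∑ y ∈ B, ∑ s ∈ Ω, Real.log (Ω.filter (R y s)).card ≤
        ∑ s ∈ Ω, Real.log (S s).card := by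
      have hfib : ∀ g : T → ℝ, ∑ k ∈ Ω.image (π x), ∑ s ∈ Ω with π x s = k, g s = ∑ s ∈ Ω, g s :=
        fun g => Finset.sum_fiberwise_of_maps_to (fun s hs => Finset.mem_image_of_mem _ hs) g
      simp_rw [← hfib]
      rw [Finset.sum_comm]
      refine Finset.sum_le_sum fun k _ => ?_
      have h := ih (Ω.filter fun s => π x s = k)
      calc _ = ∑ y ∈ B, ∑ s ∈ Ω with π x s = k,
              Real.log ((Ω.filter fun s => π x s = k).filter (R y s)).card := by
            refine Finset.sum_congr rfl fun y hy => Finset.sum_congr rfl fun s hs => ?_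
            congr 3
            ext t
            simp only [Finset.mem_filter] at hs ⊢
            have := hconst x y s t (fun h => hx (h ▸ hy))
            constructor
            · rintro ⟨h1, h2⟩; exact ⟨⟨h1, by rw [← this h2, hs.2]⟩, h2⟩
            · rintro ⟨⟨h1, _⟩, h2⟩; exact ⟨h1, h2⟩
        _ ≤ _ := h
        _ = ∑ s ∈ Ω with π x s = k, Real.log (Ω.filter fun s => π x s = k).card := by
            rw [Finset.sum_const, nsmul_eq_mul]
        _ = _ := by
            refine Finset.sum_congr rfl fun s hs => ?_
            simp only [hS, (Finset.mem_filter.1 hs).2]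
    -- A pair formed of a point on the line of `s` and a point in the slice of `s` determines `s`:
    -- the first gives its line and the second its coordinate on that line.
    have hcount : ∑ s ∈ Ω, (Ω.filter (R x s)).card * (S s).card ≤ Ω.card * Ω.card := by
      simp_rw [← Finset.card_product, ← Finset.card_sigma]
      refine Finset.card_le_card_of_injOn (fun p => p.2) ?_ ?_
      · intro p hp
        simp only [Finset.coe_sigma, Set.mem_sigma_iff, Finset.mem_coe, Finset.mem_product, hS,
          Finset.mem_filter] at hp
        exact Finset.mem_product.2 ⟨hp.2.1.1, hp.2.2.1⟩
      · rintro ⟨s, p⟩ hp ⟨t, q⟩ hq (rfl : p = q)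
        simp only [Finset.coe_sigma, Set.mem_sigma_iff, Finset.mem_coe, Finset.mem_product, hS,
          Finset.mem_filter] at hp hq
        obtain rfl : s = t := hinj x s t ((hR x).trans hp.2.1.2 ((hR x).symm hq.2.1.2))
          (hp.2.2.2.symm.trans hq.2.2.2)
        rfl
    have hmem : ∀ s ∈ Ω, 0 < (Ω.filter (R x s)).card ∧ 0 < (S s).card := fun s hs =>
      ⟨Finset.card_pos.2 ⟨s, Finset.mem_filter.2 ⟨hs, (hR x).refl s⟩⟩,
        Finset.card_pos.2 ⟨s, Finset.mem_filter.2 ⟨hs, rfl⟩⟩⟩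
    rw [Finset.sum_insert hx]
    refine (add_le_add_right hB _).trans ?_
    rw [← Finset.sum_add_distrib]
    -- The inequality `log u ≤ u - 1` plays the role of Jensen's inequality; the excess terms sum to
    -- at most zero by `hcount`.
    have hterm : ∀ s ∈ Ω, Real.log (Ω.filter (R x s)).card + Real.log (S s).card ≤
        Real.log Ω.card + (((Ω.filter (R x s)).card * (S s).card : ℕ) / (Ω.card : ℝ) - 1) := by
      intro s hs
      obtain ⟨h1, h2⟩ := hmem s hs
      have h1' : (0 : ℝ) < (Ω.filter (R x s)).card := by exact_mod_cast h1
      have h2' : (0 : ℝ) < (S s).card := by exact_mod_cast h2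
      have h3 := Real.log_le_sub_one_of_pos (div_pos (mul_pos h1' h2') hpos)
      rw [Real.log_div (by positivity) hpos.ne', Real.log_mul h1'.ne' h2'.ne'] at h3
      push_cast
      linarith
    refine (Finset.sum_le_sum hterm).trans ?_
    rw [Finset.sum_add_distrib, Finset.sum_sub_distrib, ← Finset.sum_div, ← Nat.cast_sum]
    simp only [Finset.sum_const, nsmul_eq_mul, mul_one]
    have h4 : ((∑ s ∈ Ω, (Ω.filter (R x s)).card * (S s).card : ℕ) : ℝ) / Ω.card ≤ Ω.card := by
      rw [div_le_iff₀ hpos]; exact_mod_cast hcount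
    linarith

/-- By the entropy inequality the mean of `log |fibre|` over directions and points is at most `log J
/ 4`. A fibre with fewer than `√J ≤ J / 4` points lets at least `3 J / 4` of the `J` moves exit.
Averaging gives `3 / 4 · 1 / 2 = 3 / 8`. -/
theorem mul_card_le_sum_card_exit {T ι κ : Type*} [DecidableEq T] {R : ι → T → T → Prop}
    (hR : ∀ x, Equivalence (R x)) {π : ι → T → κ} (hinj : ∀ x s t, R x s t → π x s = π x t → s = t)
    (hconst : ∀ x y s t, x ≠ y → R y s t → π x s = π x t) {B : Finset ι} {Ω : Finset T}
    {t : ι → ℕ → T → T} (ht : ∀ x j s, R x s (t x j s))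
    (htinj : ∀ x s, Function.Injective fun j => t x j s) {J : ℕ} (hJ : 16 ≤ J)
    (hΩ : (Ω.card : ℝ) ≤ (J : ℝ) ^ ((B.card : ℝ) / 4)) :
    3 / 8 * B.card * J * Ω.card ≤
      ∑ x ∈ B, ∑ j ∈ Finset.Icc 1 J, ((Ω.filter fun s => t x j s ∉ Ω).card : ℝ) := by
  classical
  have hJ' : (16 : ℝ) ≤ J := by exact_mod_cast hJ
  have hlogJ : 0 < Real.log J := Real.log_pos (by linarith)
  -- An affine function of `log |fibre|` lower-bounds the number of exits: it is at most `3 J / 4`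
  -- always and nonpositive once the fibre has at least `√J` points. No separate Markov inequality
  -- is needed.
  have hpair : ∀ x ∈ B, ∀ s ∈ Ω, 3 / 4 * J * (1 - 2 * Real.log (Ω.filter (R x s)).card / Real.log J) ≤
      (((Finset.Icc 1 J).filter fun j => t x j s ∉ Ω).card : ℝ) := by
    intro x _ s hs
    set F := Ω.filter (R x s) with hF
    have hF0 : 0 < F.card := Finset.card_pos.2 ⟨s, Finset.mem_filter.2 ⟨hs, (hR x).refl s⟩⟩
    rcases lt_or_ge (F.card : ℝ) (Real.sqrt J) with hlt | hge
    · have hin : ((Finset.Icc 1 J).filter fun j => t x j s ∈ Ω).card ≤ F.card := by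
        refine Finset.card_le_card_of_injOn (fun j => t x j s) (fun j hj => ?_) (htinj x s).injOn
        exact Finset.mem_coe.2 (Finset.mem_filter.2
          ⟨(Finset.mem_filter.1 (Finset.mem_coe.1 hj)).2, ht x j s⟩)
      have hsum := Finset.card_filter_add_card_filter_not (s := Finset.Icc 1 J)
        (fun j => t x j s ∈ Ω)
      rw [Nat.card_Icc] at hsum
      have hsum' : (((Finset.Icc 1 J).filter fun j => t x j s ∈ Ω).card : ℝ) +
          ((Finset.Icc 1 J).filter fun j => t x j s ∉ Ω).card = J := by
        exact_mod_cast hsum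
      have hin' : (((Finset.Icc 1 J).filter fun j => t x j s ∈ Ω).card : ℝ) ≤ F.card := by
        exact_mod_cast hin
      have hsq : Real.sqrt J ≤ J / 4 := by
        rw [Real.sqrt_le_left (by positivity)]; nlinarith
      have hnn : 0 ≤ 2 * Real.log F.card / Real.log J :=
        div_nonneg (mul_nonneg zero_le_two (Real.log_natCast_nonneg _)) hlogJ.le
      nlinarith
    · have hlog : Real.log J / 2 ≤ Real.log F.card := by
        rw [← Real.log_sqrt (by positivity)]
        exact Real.log_le_log (Real.sqrt_pos.2 (by linarith)) hge
      have : 1 ≤ 2 * Real.log F.card / Real.log J := by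
        rw [le_div_iff₀ hlogJ]; linarith
      refine le_trans ?_ (Nat.cast_nonneg _)
      exact mul_nonpos_of_nonneg_of_nonpos (by positivity) (by linarith)
  have hswap : ∑ x ∈ B, ∑ j ∈ Finset.Icc 1 J, ((Ω.filter fun s => t x j s ∉ Ω).card : ℝ) =
      ∑ x ∈ B, ∑ s ∈ Ω, (((Finset.Icc 1 J).filter fun j => t x j s ∉ Ω).card : ℝ) := by
    refine Finset.sum_congr rfl fun x _ => ?_
    simp only [Finset.card_filter, Nat.cast_sum]
    exact Finset.sum_comm
  rw [hswap]
  refine le_trans ?_ (Finset.sum_le_sum fun x hx => Finset.sum_le_sum (hpair x hx))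
  have hent := sum_log_card_fibre_le hR hinj hconst B Ω
  rcases Ω.eq_empty_or_nonempty with rfl | hne
  · simp
  have hpos : (0 : ℝ) < Ω.card := by exact_mod_cast hne.card_pos
  have hlogΩ : Real.log Ω.card ≤ B.card / 4 * Real.log J := by
    rw [← Real.log_rpow (by linarith)]
    exact Real.log_le_log hpos hΩ
  have hcalc : ∑ x ∈ B, ∑ s ∈ Ω, 3 / 4 * (J : ℝ) *
      (1 - 2 * Real.log (Ω.filter (R x s)).card / Real.log J) =
      3 / 4 * J * (B.card * Ω.card -
        2 / Real.log J * ∑ x ∈ B, ∑ s ∈ Ω, Real.log (Ω.filter (R x s)).card) := by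
    simp_rw [← Finset.mul_sum, Finset.sum_sub_distrib, Finset.mul_sum]
    simp [div_mul_eq_mul_div]
  rw [hcalc]
  have hbound : 2 / Real.log J * ∑ x ∈ B, ∑ s ∈ Ω, Real.log (Ω.filter (R x s)).card ≤
      B.card * Ω.card / 2 := by
    rw [div_mul_eq_mul_div, div_le_iff₀ hlogJ]
    nlinarith [mul_le_mul_of_nonneg_left hlogΩ hpos.le]
  nlinarith [mul_le_mul_of_nonneg_left hbound (by positivity : (0 : ℝ) ≤ 3 / 4 * J)]

/-- A set isoperimetric inequality implies a functional one (coarea formula). -/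
theorem mul_sum_le_sum_posPart {T I : Type*} [DecidableEq T] (s : Finset I) (t : I → T → T) (c : ℝ)
    (S : Finset T) (hS : ∀ Ω ⊆ S, c * Ω.card ≤ ∑ i ∈ s, ((Ω.filter fun ω => t i ω ∉ Ω).card : ℝ))
    (f : T → ℝ) (hf : ∀ ω, 0 ≤ f ω) (hfS : ∀ ω, ω ∉ S → f ω = 0) :
    c * ∑ ω ∈ S, f ω ≤ ∑ i ∈ s, ∑ ω ∈ S, max (f ω - f (t i ω)) 0 := by
  induction S using Finset.strongInduction generalizing f with
  | H S ih =>
    rcases S.eq_empty_or_nonempty with rfl | hne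
    · simp
    obtain ⟨s₀, hs₀, hmin⟩ := S.exists_min_image f hne
    -- Peel off the lowest layer: subtract the minimum `m` on `S` and remove the minimiser. The
    -- layer contributes `m` times the set inequality for `S`.
    set m := f s₀
    set f' : T → ℝ := fun ω => if ω ∈ S then f ω - m else 0 with hf'
    have h0 : f' s₀ = 0 := by simp [hf', hs₀, m]
    have hf'nn : ∀ ω, 0 ≤ f' ω := fun ω => by
      simp only [hf']; split_ifs with h
      · linarith [hmin ω h]
      · exact le_rfl
    have hf'S : ∀ ω, ω ∉ S.erase s₀ → f' ω = 0 := by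
      intro ω hω
      by_cases h : ω = s₀
      · rw [h, h0]
      · simp only [hf', if_neg (fun h' => hω (Finset.mem_erase.2 ⟨h, h'⟩))]
    have h1 := ih (S.erase s₀) (Finset.erase_ssubset hs₀)
      (fun Ω hΩ => hS Ω (hΩ.trans (Finset.erase_subset _ _))) f' hf'nn hf'S
    have h2 := hS S le_rfl
    have hsum : ∑ ω ∈ S, f ω = ∑ ω ∈ S.erase s₀, f' ω + m * S.card := by
      rw [Finset.sum_erase _ h0]
      rw [show m * (S.card : ℝ) = ∑ _ω ∈ S, m by simp [mul_comm], ← Finset.sum_add_distrib]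
      refine Finset.sum_congr rfl fun ω hω => ?_
      simp [hf', hω]
    have hmax : ∀ i ∈ s, ∑ ω ∈ S, max (f ω - f (t i ω)) 0 =
        ∑ ω ∈ S.erase s₀, max (f' ω - f' (t i ω)) 0 +
          m * ((S.filter fun ω => t i ω ∉ S).card : ℝ) := by
      intro i _
      rw [Finset.sum_erase]
      · rw [Finset.card_filter, Nat.cast_sum, Finset.mul_sum, ← Finset.sum_add_distrib]
        refine Finset.sum_congr rfl fun ω hω => ?_
        by_cases h : t i ω ∈ S
        · simp [hf', hω, h]
        · simp only [hf', hω, h, hfS _ h, if_true, if_false, not_false_eq_true, sub_zero, Nat.cast_one,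
            mul_one]
          rw [max_eq_left (hf ω), max_eq_left (by linarith [hmin ω hω])]
          ring
      · rw [h0]; exact max_eq_right (by linarith [hf'nn (t i s₀)])
    rw [Finset.sum_congr rfl hmax, Finset.sum_add_distrib, ← Finset.mul_sum, hsum]
    have := mul_le_mul_of_nonneg_left h2 (hf s₀)
    simp only [m] at *
    linarith

/-! ### Lamps in permutational wreath products -/

section Lamp

variable {X : Type*} {Γ : Subgroup (Equiv.Perm X)}

/-- The element of the wreath product that adds `j` to the lamp at `x`. -/
noncomputable def wreathLamp (Γ : Subgroup (Equiv.Perm X)) (x : X) (j : ℤ) : ZWreath Γ :=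
  SemidirectProduct.inl (Multiplicative.ofAdd (Finsupp.single x j))

theorem wreathLamp_add (x : X) (i j : ℤ) :
    wreathLamp Γ x (i + j) = wreathLamp Γ x i * wreathLamp Γ x j := by
  simp [wreathLamp, Finsupp.single_add]

theorem wreathLamp_zero (x : X) : wreathLamp Γ x 0 = 1 := by
  simp [wreathLamp]

theorem wreathLamp_natCast (x : X) (n : ℕ) : wreathLamp Γ x n = wreathLamp Γ x 1 ^ n := by
  induction n with
  | zero => simp [wreathLamp_zero]
  | succ n ih => rw [Nat.cast_succ, wreathLamp_add, ih, pow_succ]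

theorem toAdd_wreathLamp_mul_left (x : X) (j : ℤ) (s : ZWreath Γ) :
    Multiplicative.toAdd (wreathLamp Γ x j * s).left =
      Finsupp.single x j + Multiplicative.toAdd s.left := by
  simp [wreathLamp]

theorem inr_mul_inl_mul_inr_inv (γ : Γ) (f : X →₀ ℤ) :
    (SemidirectProduct.inr γ * SemidirectProduct.inl (Multiplicative.ofAdd f) *
      SemidirectProduct.inr γ⁻¹ : ZWreath Γ) =
      SemidirectProduct.inl (Multiplicative.ofAdd (Finsupp.domCongr (γ : Equiv.Perm X) f)) := by
  rw [← SemidirectProduct.inl_aut]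
  rfl

theorem wreathLamp_smul (γ : Γ) (x : X) (j : ℤ) :
    wreathLamp Γ ((γ : Equiv.Perm X) x) j =
      SemidirectProduct.inr γ * wreathLamp Γ x j * SemidirectProduct.inr γ⁻¹ := by
  rw [wreathLamp, wreathLamp, inr_mul_inl_mul_inr_inv]
  congr 2
  simp [Finsupp.domCongr, Finsupp.equivMapDomain_single]

/-- The relation of differing by the lamp at `x` only. -/
def SameOffLamp (x : X) (s t : ZWreath Γ) : Prop := ∃ j : ℤ, t = wreathLamp Γ x j * s

theorem sameOffLamp_equivalence (x : X) : Equivalence (SameOffLamp (Γ := Γ) x) where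
  refl s := ⟨0, by rw [wreathLamp_zero, one_mul]⟩
  symm := by
    rintro s _ ⟨j, rfl⟩
    exact ⟨-j, by rw [← mul_assoc, ← wreathLamp_add, neg_add_cancel, wreathLamp_zero, one_mul]⟩
  trans := by
    rintro s _ _ ⟨i, rfl⟩ ⟨j, rfl⟩
    exact ⟨j + i, by rw [← mul_assoc, ← wreathLamp_add]⟩

theorem wreathLamp_mul_lamp_eq_iff (x : X) (j : ℤ) (s : ZWreath Γ) :
    Multiplicative.toAdd (wreathLamp Γ x j * s).left x = Multiplicative.toAdd s.left x ↔ j = 0 := by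
  rw [toAdd_wreathLamp_mul_left, Finsupp.add_apply, Finsupp.single_eq_same]
  exact add_eq_right

open Classical in
/-- If lamps at `n` places can be moved by up to `J` at small cost, then functions with supports
of size at most `J ^ (n / 4)` have large energy. -/
theorem le_mul_of_displacement_wreathLamp_le {B : Finset X} (hB : B.Nonempty) {J : ℕ} (hJ : 16 ≤ J)
    {f : ZWreath Γ →₀ ℝ} (hf : (f.support.card : ℝ) ≤ (J : ℝ) ^ ((B.card : ℝ) / 4))
    (hf1 : ∑ x ∈ f.support, |f x| = 1) {D : ℝ≥0∞}
    (hD : ∀ x ∈ B, ∀ j ∈ Finset.Icc 1 J, displacement 1 f (wreathLamp Γ x (j : ℕ)) ≤ D) :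
    ENNReal.ofReal (3 / 8) ≤ D := by
  have hset : ∀ Ω ⊆ f.support, 3 / 8 * B.card * J * (Ω.card : ℝ) ≤
      ∑ p ∈ B ×ˢ Finset.Icc 1 J,
        ((Ω.filter fun s => wreathLamp Γ p.1 (p.2 : ℕ) * s ∉ Ω).card : ℝ) := by
    intro Ω hΩ
    rw [Finset.sum_product]
    refine mul_card_le_sum_card_exit (R := SameOffLamp) sameOffLamp_equivalence
      (π := fun x s => Multiplicative.toAdd s.left x) ?_ ?_
      (t := fun x j s => wreathLamp Γ x (j : ℕ) * s) (fun x j s => ⟨_, rfl⟩) ?_ hJ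
      (le_trans (by exact_mod_cast Finset.card_le_card hΩ) hf)
    · rintro x s _ ⟨j, rfl⟩ h
      rw [eq_comm, wreathLamp_mul_lamp_eq_iff] at h
      rw [h, wreathLamp_zero, one_mul]
    · rintro x y s _ hxy ⟨j, rfl⟩
      simp only [toAdd_wreathLamp_mul_left, Finsupp.add_apply]
      rw [Finsupp.single_eq_of_ne hxy, zero_add]
    · intro x s i j h
      have h' : wreathLamp Γ x (i : ℕ) = wreathLamp Γ x (j : ℕ) := mul_right_cancel h
      have h2 := Finsupp.single_injective x
        (Multiplicative.ofAdd.injective (SemidirectProduct.inl_injective h'))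
      exact_mod_cast h2
  have hfun := mul_sum_le_sum_posPart (B ×ˢ Finset.Icc 1 J)
    (fun p s => wreathLamp Γ p.1 (p.2 : ℕ) * s) _ f.support hset (fun s => |f s|)
    (fun s => abs_nonneg _) (fun s hs => by simp [Finsupp.notMem_support_iff.1 hs])
  rw [hf1, mul_one] at hfun
  have hsum : ENNReal.ofReal (3 / 8 * B.card * J) ≤ ∑ p ∈ B ×ˢ Finset.Icc 1 J, D := by
    refine (ENNReal.ofReal_le_ofReal hfun).trans ?_
    rw [ENNReal.ofReal_sum_of_nonneg fun p _ => Finset.sum_nonneg fun s _ => le_max_right _ _]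
    refine Finset.sum_le_sum fun p hp => ?_
    obtain ⟨hp1, hp2⟩ := Finset.mem_product.1 hp
    refine le_trans ?_ (hD p.1 hp1 p.2 hp2)
    rw [ENNReal.ofReal_sum_of_nonneg fun s _ => le_max_right _ _]
    refine le_trans (Finset.sum_le_sum fun s _ => ENNReal.ofReal_le_ofReal ?_)
      (ENNReal.sum_le_tsum f.support)
    rw [pow_one]
    refine max_le ?_ (abs_nonneg _)
    rw [abs_sub_comm]
    exact abs_sub_abs_le_abs_sub _ _
  have hBJ : (0 : ℝ) < B.card * J := by
    have := hB.card_pos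
    have : (0 : ℝ) < B.card := by exact_mod_cast this
    have : (0 : ℝ) < J := by exact_mod_cast (by omega : 0 < J)
    positivity
  rw [Finset.sum_const, Finset.card_product, Nat.card_Icc, Nat.add_sub_cancel, nsmul_eq_mul,
    show (3 / 8 * B.card * J : ℝ) = (B.card * J) * (3 / 8) by ring, ENNReal.ofReal_mul hBJ.le,
    show ((B.card * J : ℕ) : ℝ≥0∞) = ENNReal.ofReal (B.card * J) by
      rw [← Nat.cast_mul, ENNReal.ofReal_natCast]] at hsum
  exact (ENNReal.mul_le_mul_iff_right (ENNReal.ofReal_pos.2 hBJ).ne' ENNReal.ofReal_ne_top).1 hsum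

end Lamp

/-! ### The generators of the bubble group -/

section Bubble

variable {a : ℕ → ℕ+} {b : ℕ}

/-- The generator `α` of the bubble group. -/
def bubbleGenAlpha (a : ℕ → ℕ+) (b : ℕ) : bubbleGroup a b :=
  ⟨bubbleAlpha a b, Subgroup.subset_closure (Set.mem_insert _ _)⟩

/-- The generator `β` of the bubble group. -/
def bubbleGenBeta (a : ℕ → ℕ+) (b : ℕ) : bubbleGroup a b :=
  ⟨bubbleBeta a b, Subgroup.subset_closure (Set.mem_insert_of_mem _ rfl)⟩

/-- Each edge is an application of `α`, `β` or an inverse, and each such letter has displacement at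
most `M`. The resulting element transports the lamp at the root to any vertex of the ball. -/
theorem exists_apply_eq_of_walk {x y : BubbleVertex a b} (p : (bubbleGraph a b).Walk x y)
    (f : ZWreath (bubbleGroup a b) → ℝ) {M : ℝ≥0∞}
    (hα : displacement 1 f (SemidirectProduct.inr (bubbleGenAlpha a b)) ≤ M)
    (hβ : displacement 1 f (SemidirectProduct.inr (bubbleGenBeta a b)) ≤ M) :
    ∃ γ : bubbleGroup a b, (γ : Equiv.Perm _) x = y ∧
      displacement 1 f (SemidirectProduct.inr γ) ≤ p.length * M := by
  induction p with
  | nil => exact ⟨1, rfl, by simp [displacement_one]⟩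
  | @cons x z y h p ih =>
    obtain ⟨γ, hγ, hle⟩ := ih
    have step : ∃ σ : bubbleGroup a b, (σ : Equiv.Perm _) x = z ∧
        displacement 1 f (SemidirectProduct.inr σ) ≤ M := by
      have hinv : ∀ σ : bubbleGroup a b, displacement 1 f (SemidirectProduct.inr σ) ≤ M →
          displacement 1 f (SemidirectProduct.inr σ⁻¹) ≤ M := fun σ h => by
        rw [map_inv, displacement_inv]; exact h
      rw [bubbleGraph, SimpleGraph.fromRel_adj] at h
      rcases h.2 with (h | h) | (h | h)
      · exact ⟨bubbleGenAlpha a b, h.symm, hα⟩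
      · exact ⟨bubbleGenBeta a b, h.symm, hβ⟩
      · exact ⟨(bubbleGenAlpha a b)⁻¹, by
          rw [h]; exact (bubbleAlpha a b).symm_apply_apply z, hinv _ hα⟩
      · exact ⟨(bubbleGenBeta a b)⁻¹, by
          rw [h]; exact (bubbleBeta a b).symm_apply_apply z, hinv _ hβ⟩
    obtain ⟨σ, hσ, hσM⟩ := step
    refine ⟨γ * σ, by rw [← hγ, ← hσ]; rfl, ?_⟩
    rw [map_mul]
    refine (displacement_one_mul_le f _ _).trans ?_
    rw [SimpleGraph.Walk.length_cons, Nat.cast_succ, add_mul, one_mul]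
    exact add_le_add hle hσM

/-- Moving to `x`, switching the root lamp `j` times and moving back costs at most `2 r + J ≤ 19 r`
displacements of generators; the isoperimetry of the lamps over the ball does the rest. -/
theorem exists_le_profileOne (φ : PMF (ZWreath (bubbleGroup a b))) (hφ : IsSymmetricGenerating φ) :
    ∃ C : ℝ, 4 ≤ C ∧ ∀ r : ℝ, 1 < r → ∀ v : ℝ,
      v ≤ C⁻¹ * r ^ (((bubbleBall a b r).ncard : ℝ) / C) →
        ENNReal.ofReal (1 / (C * r)) ≤ profileOne φ v := by
  obtain ⟨K₁, hK₁, h₁⟩ := exists_displacement_one_le_walkEnergy hφ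
    (SemidirectProduct.inr (bubbleGenAlpha a b))
  obtain ⟨K₂, hK₂, h₂⟩ := exists_displacement_one_le_walkEnergy hφ
    (SemidirectProduct.inr (bubbleGenBeta a b))
  obtain ⟨K₃, hK₃, h₃⟩ := exists_displacement_one_le_walkEnergy hφ
    (wreathLamp (bubbleGroup a b) (bubbleRoot a b) 1)
  set K := K₁ + K₂ + K₃ + 1 with hK
  have hK0 : 0 < K := by positivity
  refine ⟨51 * K + 4, by linarith, fun r hr v hv => ?_⟩
  set C := 51 * K + 4 with hC
  have hC4 : 4 ≤ C := by linarith
  refine le_iInf₂ fun f hfv => le_iInf fun hf1 => ?_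
  rcases f.support.eq_empty_or_nonempty with hemp | hne
  · rw [hemp] at hf1
    simp at hf1
  have hcard : (1 : ℝ) ≤ f.support.card := by
    exact_mod_cast hne.card_pos
  -- If `ncard` were 0, as it would be for an infinite ball, then `v ≤ C⁻¹ < 1`, which excludes
  -- nonempty supports. Finiteness of the ball therefore need not be known here.
  have hn0 : (bubbleBall a b r).ncard ≠ 0 := by
    intro h
    rw [h, Nat.cast_zero, zero_div, Real.rpow_zero, mul_one] at hv
    have : C⁻¹ < 1 := inv_lt_one_of_one_lt₀ (by linarith)
    linarith
  have hfin : (bubbleBall a b r).Finite := Set.finite_of_ncard_ne_zero hn0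
  set B := hfin.toFinset with hB
  have hBcard : B.card = (bubbleBall a b r).ncard := (Set.ncard_eq_toFinset_card _ hfin).symm
  set E := walkEnergy φ 1 f with hE
  have hM : ∀ L : ℝ, L ≤ K → ENNReal.ofReal L * E ≤ ENNReal.ofReal K * E := fun L hL =>
    mul_le_mul_left (ENNReal.ofReal_le_ofReal hL) _
  set J := ⌈16 * r⌉₊ with hJ
  have hJ16 : 16 * r ≤ J := Nat.le_ceil _
  have hJ17 : (J : ℝ) ≤ 17 * r := (Nat.ceil_lt_add_one (by linarith)).le.trans (by linarith)
  have key : ENNReal.ofReal (3 / 8) ≤ ENNReal.ofReal (19 * r) * (ENNReal.ofReal K * E) := by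
    refine le_mul_of_displacement_wreathLamp_le (B := B) (J := J) ?_ ?_ ?_ hf1 ?_
    · rw [← Finset.card_pos, hBcard]; omega
    · have : (16 : ℝ) ≤ J := by linarith
      exact_mod_cast this
    · refine hfv.trans (hv.trans ?_)
      rw [hBcard]
      refine (mul_le_of_le_one_left (by positivity) (inv_le_one_of_one_le₀ (by linarith))).trans ?_
      refine (Real.rpow_le_rpow_of_exponent_le hr.le ?_).trans
        (Real.rpow_le_rpow (by linarith) (by linarith : r ≤ (J : ℝ)) (by positivity))
      exact div_le_div_of_nonneg_left (by positivity) (by norm_num) hC4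
    · intro x hx j hj
      obtain ⟨p, hp⟩ := hfin.mem_toFinset.1 hx
      obtain ⟨γ, hγ, hle⟩ := exists_apply_eq_of_walk p f ((h₁ f).trans (hM K₁ (by linarith)))
        ((h₂ f).trans (hM K₂ (by linarith)))
      rw [← hγ, wreathLamp_smul]
      refine (displacement_one_mul_le f _ _).trans ((add_le_add_left
        (displacement_one_mul_le f _ _) _).trans ?_)
      rw [map_inv, displacement_inv, wreathLamp_natCast]
      have hlamp := (displacement_one_pow_le f (wreathLamp (bubbleGroup a b) (bubbleRoot a b) 1)
        j).trans (mul_le_mul_right ((h₃ f).trans (hM K₃ (by linarith))) _)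
      refine (add_le_add (add_le_add hle hlamp) hle).trans ?_
      rw [← add_mul, ← add_mul]
      refine mul_le_mul_left ?_ _
      rw [← ENNReal.ofReal_natCast, ← ENNReal.ofReal_natCast, ← ENNReal.ofReal_add (by positivity)
        (by positivity), ← ENNReal.ofReal_add (by positivity) (by positivity)]
      apply ENNReal.ofReal_le_ofReal
      have hjJ : (j : ℝ) ≤ J := by exact_mod_cast (Finset.mem_Icc.1 hj).2
      linarith
  rw [← mul_assoc, ← ENNReal.ofReal_mul (by linarith)] at key
  have hpos : 0 < 19 * r * K := by positivity
  have h := ENNReal.div_le_of_le_mul' key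
  rw [← ENNReal.ofReal_div_of_pos hpos] at h
  refine le_trans (ENNReal.ofReal_le_ofReal ?_) h
  rw [div_le_div_iff₀ (by positivity) hpos]
  nlinarith

end Bubble

section Bubble

variable {a : ℕ → ℕ+} {b : ℕ}

/-! ### Rotations and branching cycles -/

theorem bubbleAlpha_zpow_apply (j : ℤ) (x : BubbleVertex a b) :
    (bubbleAlpha a b ^ j) x = ⟨x.1, x.2 + (j : ZMod (2 * (a (x.1.length + 1) : ℕ)))⟩ := by
  have hα : ∀ y : BubbleVertex a b, bubbleAlpha a b y = ⟨y.1, y.2 + 1⟩ := fun y => rfl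
  have hα' : ∀ y : BubbleVertex a b, (bubbleAlpha a b)⁻¹ y = ⟨y.1, y.2 - 1⟩ := fun y => by
    rw [Equiv.Perm.inv_eq_iff_eq, hα]; simp
  induction j using Int.induction_on with
  | zero => simp
  | succ i ih =>
    rw [add_comm, zpow_add, zpow_one, Equiv.Perm.mul_apply, ih, hα]
    refine congrArg (Sigma.mk x.1) ?_
    push_cast
    ring
  | pred i ih =>
    rw [sub_eq_add_neg, add_comm, zpow_add, zpow_neg_one, Equiv.Perm.mul_apply, ih, hα']
    refine congrArg (Sigma.mk x.1) ?_
    push_cast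
    ring

theorem bubbleAlpha_zpow_apply_start (j : ℤ) (w : BubbleWord b) :
    (bubbleAlpha a b ^ j) (bubbleStart a w) =
      ⟨w, (j : ZMod (2 * (a (w.length + 1) : ℕ)))⟩ := by
  rw [bubbleAlpha_zpow_apply]
  exact congrArg (Sigma.mk w) (zero_add _)

theorem mk_eq_bubbleEnd_iff {w : BubbleWord b} {u : ZMod (2 * (a (w.length + 1) : ℕ))} :
    (⟨w, u⟩ : BubbleVertex a b) = bubbleEnd a w ↔ u = (a (w.length + 1) : ℕ) := by
  simp [bubbleEnd]

theorem mk_eq_bubbleStart_iff {w : BubbleWord b} {u : ZMod (2 * (a (w.length + 1) : ℕ))} :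
    (⟨w, u⟩ : BubbleVertex a b) = bubbleStart a w ↔ u = 0 := by
  simp [bubbleStart]

/-- The vertices of the bubbles at which branching cycles may be attached. -/
def IsBranchVertex (x : BubbleVertex a b) : Prop := x = bubbleEnd a x.1 ∨ x = bubbleStart a x.1

/-- The only candidates on a bubble are the positions `0` and `a`, antipodal on a cycle of length `2
a`; a nontrivial rotation by less than `a` cannot map one candidate to a candidate. -/
theorem IsBranchVertex.not_zpow {x : BubbleVertex a b} (hx : IsBranchVertex x) {i : ℤ} (hi : i ≠ 0)
    (hia : |i| < (a (x.1.length + 1) : ℕ)) : ¬ IsBranchVertex ((bubbleAlpha a b ^ i) x) := by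
  obtain ⟨w, u⟩ := x
  rw [bubbleAlpha_zpow_apply]
  unfold IsBranchVertex at *
  simp only [mk_eq_bubbleEnd_iff, mk_eq_bubbleStart_iff] at *
  set n : ℕ := (a (w.length + 1) : ℕ) with hn
  -- The differences between two candidate positions are `-a`, `0` and `a`.
  have key : ∀ e : ℤ, (e = -1 ∨ e = 0 ∨ e = 1) → (i : ZMod (2 * n)) ≠ ((e * n : ℤ) : ZMod (2 * n)) := by
    intro e he h
    rw [ZMod.intCast_eq_intCast_iff_dvd_sub] at h
    obtain ⟨t, ht⟩ := h
    rw [abs_lt] at hia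
    push_cast at ht
    rcases lt_trichotomy t 0 with h | h | h
    · rcases he with rfl | rfl | rfl <;> nlinarith
    · subst h
      rcases he with rfl | rfl | rfl
      · linarith
      · exact hi (by linarith)
      · linarith
    · rcases he with rfl | rfl | rfl <;> nlinarith
  rcases hx with rfl | rfl
  · rintro (h | h)
    · refine key 0 (by simp) ?_
      simpa using h
    · refine key (-1) (by simp) ?_
      push_cast
      rw [neg_one_mul]
      exact eq_neg_of_add_eq_zero_right h
  · rintro (h | h)
    · refine key 1 (by simp) ?_
      simpa using h
    · refine key 0 (by simp) ?_
      simpa using h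

/-- The branching cycle attached to the far end of the bubble of `w`. -/
def bubbleCycle (a : ℕ → ℕ+) (w : BubbleWord b) : Set (BubbleVertex a b) :=
  {x | x = bubbleEnd a w ∨ ∃ z, x = bubbleStart a (z :: w)}

theorem isBranchVertex_of_mem_bubbleCycle {x : BubbleVertex a b} {w : BubbleWord b}
    (h : x ∈ bubbleCycle a w) : IsBranchVertex x := by
  rcases h with rfl | ⟨z, rfl⟩
  · exact Or.inl rfl
  · exact Or.inr rfl

theorem bubbleBeta_apply_mem {x : BubbleVertex a b} {w : BubbleWord b}
    (h : x ∈ bubbleCycle a w) : bubbleBeta a b x ∈ bubbleCycle a w := by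
  rcases h with rfl | ⟨z, rfl⟩
  · change bubbleBetaFun a b _ ∈ _
    rw [bubbleBetaFun_end]
    split_ifs
    · exact Or.inr ⟨_, rfl⟩
    · exact Or.inl rfl
  · change bubbleBetaFun a b _ ∈ _
    rw [bubbleBetaFun_start_cons]
    split_ifs
    · exact Or.inr ⟨_, rfl⟩
    · exact Or.inl rfl

theorem bubbleBeta_inv_apply_mem {x : BubbleVertex a b} {w : BubbleWord b}
    (h : x ∈ bubbleCycle a w) : (bubbleBeta a b)⁻¹ x ∈ bubbleCycle a w := by
  rcases h with rfl | ⟨z, rfl⟩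
  · change bubbleBetaInv a b _ ∈ _
    rw [bubbleBetaInv_end]
    split_ifs
    · exact Or.inr ⟨_, rfl⟩
    · exact Or.inl rfl
  · change bubbleBetaInv a b _ ∈ _
    rw [bubbleBetaInv_start_cons]
    split_ifs
    · exact Or.inr ⟨_, rfl⟩
    · exact Or.inl rfl

theorem bubbleBeta_zpow_apply_mem {x : BubbleVertex a b} {w : BubbleWord b}
    (h : x ∈ bubbleCycle a w) (i : ℤ) : (bubbleBeta a b ^ i) x ∈ bubbleCycle a w := by
  induction i using Int.induction_on with
  | zero => simpa using h
  | succ i ih =>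
    rw [add_comm, zpow_add, zpow_one, Equiv.Perm.mul_apply]
    exact bubbleBeta_apply_mem ih
  | pred i ih =>
    rw [sub_eq_add_neg, add_comm, zpow_add, zpow_neg_one, Equiv.Perm.mul_apply]
    exact bubbleBeta_inv_apply_mem ih

theorem bubbleBeta_apply_eq_self {x : BubbleVertex a b} (h : ∀ w, x ∉ bubbleCycle a w) :
    bubbleBeta a b x = x := by
  obtain ⟨w, u⟩ := x
  change bubbleBetaFun a b _ = _
  by_cases h1 : (⟨w, u⟩ : BubbleVertex a b) = bubbleEnd a w
  · exact absurd (Or.inl h1) (h w)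
  by_cases h2 : (⟨w, u⟩ : BubbleVertex a b) = bubbleStart a w
  · cases w with
    | nil => rw [h2]; exact bubbleBetaFun_start_nil a b
    | cons z w => exact absurd (Or.inr ⟨z, h2⟩) (h w)
  exact bubbleBetaFun_of_ne a _ h1 h2

theorem bubbleBeta_zpow_apply_eq_self {x : BubbleVertex a b} (h : ∀ w, x ∉ bubbleCycle a w)
    (i : ℤ) : (bubbleBeta a b ^ i) x = x :=
  Equiv.Perm.zpow_apply_eq_self_of_apply_eq_self (bubbleBeta_apply_eq_self h) i

theorem bubbleBeta_pow_succ_apply_end (w : BubbleWord b) (i : ℕ) (h : i < b - 1) :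
    (bubbleBeta a b ^ (i + 1)) (bubbleEnd a w) = bubbleStart a (⟨i, h⟩ :: w) := by
  induction i with
  | zero =>
    rw [zero_add, pow_one]
    change bubbleBetaFun a b _ = _
    rw [bubbleBetaFun_end, dif_pos h]
  | succ i ih =>
    rw [pow_succ', Equiv.Perm.mul_apply, ih (by omega)]
    change bubbleBetaFun a b _ = _
    rw [bubbleBetaFun_start_cons, dif_pos h]

theorem bubbleBeta_pow_eq_one (hb : 2 ≤ b) : bubbleBeta a b ^ b = 1 := by
  have hend : ∀ w : BubbleWord b, (bubbleBeta a b ^ b) (bubbleEnd a w) = bubbleEnd a w := by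
    intro w
    obtain ⟨n, rfl⟩ : ∃ n, b = n + 2 := ⟨b - 2, by omega⟩
    have hpow : bubbleBeta a (n + 2) ^ (n + 2) = bubbleBeta a (n + 2) * bubbleBeta a (n + 2) ^ (n + 1) :=
      pow_succ' _ _
    rw [hpow, Equiv.Perm.mul_apply, bubbleBeta_pow_succ_apply_end w n (by omega)]
    change bubbleBetaFun a _ _ = _
    rw [bubbleBetaFun_start_cons, dif_neg (by simp only; omega)]
  ext1 x
  rw [Equiv.Perm.one_apply]
  by_cases h : ∃ w, x ∈ bubbleCycle a w
  · obtain ⟨w, rfl | ⟨z, rfl⟩⟩ := h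
    · exact hend w
    · rw [← bubbleBeta_pow_succ_apply_end w z.1 z.2, ← Equiv.Perm.mul_apply, ← pow_add, add_comm,
        pow_add, Equiv.Perm.mul_apply, hend]
  · push Not at h
    exact_mod_cast bubbleBeta_zpow_apply_eq_self h b

theorem exists_bubbleGroup_apply_root (x : BubbleVertex a b) :
    ∃ γ : bubbleGroup a b, (γ : Equiv.Perm _) (bubbleRoot a b) = x := by
  have hst : ∀ w : BubbleWord b, ∃ γ : bubbleGroup a b,
      (γ : Equiv.Perm _) (bubbleRoot a b) = bubbleStart a w := by
    intro w
    induction w with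
    | nil => exact ⟨1, rfl⟩
    | cons z w ih =>
      obtain ⟨γ, hγ⟩ := ih
      refine ⟨bubbleGenBeta a b ^ (z.1 + 1) *
        (bubbleGenAlpha a b ^ ((a (w.length + 1) : ℕ) : ℤ) * γ), ?_⟩
      rw [← bubbleBeta_pow_succ_apply_end w z.1 z.2]
      change (bubbleBeta a b ^ (z.1 + 1)) ((bubbleAlpha a b ^ ((a (w.length + 1) : ℕ) : ℤ))
        ((γ : Equiv.Perm _) (bubbleRoot a b))) = _
      rw [hγ, bubbleAlpha_zpow_apply_start, Int.cast_natCast]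
      rfl
  obtain ⟨w, u⟩ := x
  obtain ⟨γ, hγ⟩ := hst w
  refine ⟨bubbleGenAlpha a b ^ (u.val : ℤ) * γ, ?_⟩
  change (bubbleAlpha a b ^ (u.val : ℤ)) ((γ : Equiv.Perm _) (bubbleRoot a b)) = _
  have : NeZero (2 * (a (w.length + 1) : ℕ)) := ⟨by positivity⟩
  rw [hγ, bubbleAlpha_zpow_apply_start, Int.cast_natCast, ZMod.natCast_zmod_val]

/-! ### Levels -/

theorem ncard_words (b n : ℕ) :
    {w : BubbleWord b | w.length = n}.Finite ∧
      {w : BubbleWord b | w.length = n}.ncard = (b - 1) ^ n := by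
  refine ⟨List.finite_length_eq _ n, ?_⟩
  rw [← Nat.card_coe_set_eq]
  change Nat.card (List.Vector (Fin (b - 1)) n) = _
  rw [Nat.card_eq_fintype_card, card_vector, Fintype.card_fin]

theorem levelSet_eq_image (n : ℕ) :
    {x : BubbleVertex a b | x.1.length = n} =
      (fun p : BubbleWord b × ℕ => (bubbleAlpha a b ^ (p.2 : ℤ)) (bubbleStart a p.1)) ''
        ({w : BubbleWord b | w.length = n} ×ˢ Set.Iio (2 * (a (n + 1) : ℕ))) := by
  ext ⟨w, u⟩
  simp only [Set.mem_ofPred_eq, Set.mem_image, Set.mem_prod, Set.mem_Iio, Prod.exists,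
    bubbleAlpha_zpow_apply_start]
  have : NeZero (2 * (a (w.length + 1) : ℕ)) := ⟨by positivity⟩
  constructor
  · rintro rfl
    exact ⟨w, u.val, ⟨rfl, ZMod.val_lt u⟩, by rw [Int.cast_natCast, ZMod.natCast_zmod_val]⟩
  · rintro ⟨w', i, ⟨h, _⟩, h'⟩
    exact (congrArg (fun x : BubbleVertex a b => x.1.length) h').symm.trans h

theorem ncard_levelSet (n : ℕ) :
    {x : BubbleVertex a b | x.1.length = n}.Finite ∧
      {x : BubbleVertex a b | x.1.length = n}.ncard = (b - 1) ^ n * (2 * (a (n + 1) : ℕ)) := by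
  rw [levelSet_eq_image]
  refine ⟨((ncard_words b n).1.prod (Set.finite_Iio _)).image _, ?_⟩
  rw [Set.InjOn.ncard_image, Set.ncard_prod, (ncard_words b n).2]
  · congr 1
    rw [← Nat.card_coe_set_eq]
    simp
  · rintro ⟨w, i⟩ ⟨hw, hi⟩ ⟨w', j⟩ ⟨_, hj⟩ h
    simp only [bubbleAlpha_zpow_apply_start, Set.mem_ofPred_eq, Set.mem_Iio] at *
    obtain rfl : w = w' := congrArg Sigma.fst h
    simp only [Sigma.mk.injEq, heq_eq_eq, true_and, Int.cast_natCast] at h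
    rw [ZMod.natCast_eq_natCast_iff, hw] at h
    rw [Nat.ModEq.eq_of_lt_of_lt h hi hj]

theorem bubbleLevels_succ (m : ℕ) :
    bubbleLevels a b (m + 1) = bubbleLevels a b m ∪ {x | x.1.length = m} := by
  ext x
  simp only [bubbleLevels, bubbleLevel, Set.mem_ofPred_eq, Set.mem_union]
  omega

theorem bubbleLevels_finite (m : ℕ) : (bubbleLevels a b m).Finite := by
  induction m with
  | zero =>
    convert Set.finite_empty
    ext x
    simp [bubbleLevels, bubbleLevel]
  | succ m ih => rw [bubbleLevels_succ]; exact ih.union (ncard_levelSet m).1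

theorem ncard_bubbleLevels_le (m : ℕ) :
    (bubbleLevels a b m).ncard ≤ ∑ n ∈ Finset.range m, (b - 1) ^ n * (2 * (a (n + 1) : ℕ)) := by
  induction m with
  | zero =>
    have : bubbleLevels a b 0 = ∅ := by
      ext x
      simp [bubbleLevels, bubbleLevel]
    simp [this]
  | succ m ih =>
    rw [bubbleLevels_succ, Finset.sum_range_succ]
    exact (Set.ncard_union_le _ _).trans (add_le_add ih (ncard_levelSet m).2.le)

theorem le_ncard_bubbleLevels (m : ℕ) :
    (b - 1) ^ m * (2 * (a (m + 1) : ℕ)) ≤ (bubbleLevels a b (m + 1)).ncard := by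
  rw [← (ncard_levelSet (a := a) (b := b) m).2]
  refine Set.ncard_le_ncard ?_ (bubbleLevels_finite _)
  rw [bubbleLevels_succ]
  exact Set.subset_union_right

/-! ### The core -/

/-- The vertices of level less than `k` together with those of level `k` at distance less than `R`
from the origin of their bubble. -/
def bubbleCore (a : ℕ → ℕ+) (b k R : ℕ) : Set (BubbleVertex a b) :=
  {x | x.1.length + 1 < k ∨ ∃ (w : BubbleWord b) (j : ℤ), w.length + 1 = k ∧ |j| < R ∧
    x = (bubbleAlpha a b ^ j) (bubbleStart a w)}

theorem bubbleCore_finite (k R : ℕ) (hk : 1 ≤ k) :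
    (bubbleCore a b k R).Finite ∧
      (bubbleCore a b k R).ncard ≤ (bubbleLevels a b (k - 1)).ncard + (b - 1) ^ (k - 1) * (2 * R) := by
  have hsub : bubbleCore a b k R ⊆ bubbleLevels a b (k - 1) ∪
      (fun p : BubbleWord b × ℤ => (bubbleAlpha a b ^ p.2) (bubbleStart a p.1)) ''
        ({w : BubbleWord b | w.length = k - 1} ×ˢ Set.Ico (-R : ℤ) R) := by
    rintro x (h | ⟨w, j, h, hj, rfl⟩)
    · left
      simp only [bubbleLevels, bubbleLevel, Set.mem_ofPred_eq]
      omega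
    · right
      rw [abs_lt] at hj
      refine ⟨⟨w, j⟩, ⟨?_, ?_⟩, rfl⟩
      · simp only [Set.mem_ofPred_eq]; omega
      · simp only [Set.mem_Ico]; omega
  have hfin2 := (ncard_words b (k - 1)).1.prod (Set.finite_Ico (-R : ℤ) R)
  have hfin := (bubbleLevels_finite (a := a) (b := b) (k - 1)).union (hfin2.image
    (fun p : BubbleWord b × ℤ => (bubbleAlpha a b ^ p.2) (bubbleStart a p.1)))
  refine ⟨hfin.subset hsub, (Set.ncard_le_ncard hsub hfin).trans ((Set.ncard_union_le _ _).trans ?_)⟩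
  refine add_le_add_right ((Set.ncard_image_le hfin2).trans ?_) _
  rw [Set.ncard_prod, (ncard_words b (k - 1)).2]
  refine Nat.mul_le_mul_left _ ?_
  rw [← Nat.card_coe_set_eq, Nat.card_eq_fintype_card, Fintype.card_ofFinset, Int.card_Ico]
  omega

/-! ### Action of the conjugates of `β` on the core and outside it; finiteness of the local group.
-/

section Local

variable {k R : ℕ}

/-- A core vertex of level `k`, rotated by less than `R`, stays at distance less than `2 R ≤ a` from
the origin of its bubble. It can thus meet a branching cycle only at that origin, and this cycle
hangs from a bubble of level `k - 1`. -/
theorem length_lt_of_mem_core (hR : ∀ m, k ≤ m → 2 * R ≤ (a m : ℕ)) {x : BubbleVertex a b}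
    (hx : x ∈ bubbleCore a b k R) {A : ℤ} (hA : |A| < R) {w : BubbleWord b}
    (h : (bubbleAlpha a b ^ A) x ∈ bubbleCycle a w) : w.length + 1 < k := by
  rcases hx with hx | ⟨v, j, hv, hj, rfl⟩
  · rw [bubbleAlpha_zpow_apply] at h
    rcases h with h | ⟨z, h⟩
    · have := congrArg Sigma.fst h
      simp only [bubbleEnd] at this
      rw [← this]; exact hx
    · have := congrArg Sigma.fst h
      simp only [bubbleStart] at this
      rw [this, List.length_cons] at hx
      omega
  · rw [← Equiv.Perm.mul_apply, ← zpow_add] at h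
    by_cases h0 : A + j = 0
    · rw [h0, zpow_zero, Equiv.Perm.one_apply] at h
      rcases h with h | ⟨z, h⟩
      · exact absurd h.symm (bubbleEnd_ne_bubbleStart a w v)
      · have := congrArg Sigma.fst h
        simp only [bubbleStart] at this
        rw [this, List.length_cons] at hv
        omega
    · refine absurd (isBranchVertex_of_mem_bubbleCycle h)
        (IsBranchVertex.not_zpow (Or.inr rfl) h0 ?_)
      have := hR (v.length + 1) hv.ge
      rw [abs_lt] at *
      simp only [bubbleStart]
      omega

/-- A point moved along a cycle hanging from level below `k` lands at level below `k`, or at the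
origin of a bubble of level `k`; rotating back by `A` then leaves it within distance `R` of that
origin. This dictates the shape of the core. -/
theorem conj_apply_mem_core (hR : ∀ m, k ≤ m → 2 * R ≤ (a m : ℕ)) {x : BubbleVertex a b}
    (hx : x ∈ bubbleCore a b k R) {A : ℤ} (hA : |A| < R) (i : ℤ) :
    (bubbleAlpha a b ^ (-A)) ((bubbleBeta a b ^ i) ((bubbleAlpha a b ^ A) x)) ∈
      bubbleCore a b k R := by
  by_cases h : ∃ w, (bubbleAlpha a b ^ A) x ∈ bubbleCycle a w
  · obtain ⟨w, hw⟩ := h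
    have hlen := length_lt_of_mem_core hR hx hA hw
    rcases bubbleBeta_zpow_apply_mem hw i with h | ⟨z, h⟩
    · rw [h]
      left
      rw [bubbleAlpha_zpow_apply]
      exact hlen
    · rw [h]
      by_cases hk : w.length + 2 = k
      · exact Or.inr ⟨z :: w, -A, by simpa using hk, by rwa [abs_neg], rfl⟩
      · left
        rw [bubbleAlpha_zpow_apply]
        simp only [bubbleStart, List.length_cons]
        omega
  · push Not at h
    rw [bubbleBeta_zpow_apply_eq_self h, ← Equiv.Perm.mul_apply, ← zpow_add]
    simpa using hx

theorem conj_apply_mem_core_iff (hR : ∀ m, k ≤ m → 2 * R ≤ (a m : ℕ)) {x : BubbleVertex a b}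
    {A : ℤ} (hA : |A| < R) (i : ℤ) :
    (bubbleAlpha a b ^ (-A)) ((bubbleBeta a b ^ i) ((bubbleAlpha a b ^ A) x)) ∈
      bubbleCore a b k R ↔ x ∈ bubbleCore a b k R := by
  refine ⟨fun h => ?_, fun h => conj_apply_mem_core hR h hA i⟩
  have := conj_apply_mem_core hR h hA (-i)
  simpa using this

theorem le_length_of_notMem_core {x : BubbleVertex a b} (hx : x ∉ bubbleCore a b k R) {j : ℤ}
    (hj : |j| < R) {w : BubbleWord b} (h : (bubbleAlpha a b ^ j) x ∈ bubbleCycle a w) :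
    k ≤ w.length + 1 := by
  by_contra hlt
  push Not at hlt
  refine hx ?_
  have hx' : x = (bubbleAlpha a b ^ (-j)) ((bubbleAlpha a b ^ j) x) := by simp
  rcases h with h | ⟨z, h⟩
  · left
    rw [hx', h, bubbleAlpha_zpow_apply]
    exact hlt
  · rw [h] at hx'
    by_cases hk : w.length + 2 = k
    · exact Or.inr ⟨z :: w, -j, by simpa using hk, by rwa [abs_neg], hx'⟩
    · left
      rw [hx', bubbleAlpha_zpow_apply]
      simp only [bubbleStart, List.length_cons]
      omega

/-- Two rotations by less than `R` differ by less than `2 R ≤ a`, too little to join two branch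
vertices of a bubble of level at least `k`. So outside the core distinct conjugates of `β` never
move the same point, and the lamps of `IsCoreLocal` do not interact. -/
theorem notMem_bubbleCycle_of_ne (hR : ∀ m, k ≤ m → 2 * R ≤ (a m : ℕ)) {x : BubbleVertex a b}
    (hx : x ∉ bubbleCore a b k R) {j A : ℤ} (hj : |j| < R) (hA : |A| < R) (hjA : j ≠ A)
    {w : BubbleWord b} (h : (bubbleAlpha a b ^ j) x ∈ bubbleCycle a w) (w' : BubbleWord b) :
    (bubbleAlpha a b ^ A) x ∉ bubbleCycle a w' := by
  intro h'
  have hk := le_length_of_notMem_core hx hj h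
  have hbr := isBranchVertex_of_mem_bubbleCycle h'
  have hrew : (bubbleAlpha a b ^ A) x = (bubbleAlpha a b ^ (A - j)) ((bubbleAlpha a b ^ j) x) := by
    rw [← Equiv.Perm.mul_apply, ← zpow_add, sub_add_cancel]
  rw [hrew] at hbr
  refine (isBranchVertex_of_mem_bubbleCycle h).not_zpow (sub_ne_zero.2 hjA.symm) ?_ hbr
  have hlevel : k ≤ ((bubbleAlpha a b ^ j) x).1.length + 1 := by
    rcases h with h | ⟨z, h⟩ <;> rw [h]
    · exact hk
    · simp only [bubbleStart, List.length_cons]; omega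
  have := hR _ hlevel
  rw [abs_lt] at *
  omega

/-- `h` preserves the core and acts as a lamplighter with lamps `c` near the branching cycles outside
of the core. -/
structure IsCoreLocal (k R : ℕ) (h : Equiv.Perm (BubbleVertex a b)) (c : ℤ → ℤ) : Prop where
  core : ∀ x, h x ∈ bubbleCore a b k R ↔ x ∈ bubbleCore a b k R
  far : ∀ x, x ∉ bubbleCore a b k R →
    (∀ j : ℤ, |j| < R → ∀ w, (bubbleAlpha a b ^ j) x ∉ bubbleCycle a w) → h x = x
  near : ∀ x, x ∉ bubbleCore a b k R → ∀ j : ℤ, |j| < R → ∀ w,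
    (bubbleAlpha a b ^ j) x ∈ bubbleCycle a w →
      h x = (bubbleAlpha a b ^ (-j)) ((bubbleBeta a b ^ c j) ((bubbleAlpha a b ^ j) x))

theorem IsCoreLocal.one : IsCoreLocal k R (1 : Equiv.Perm (BubbleVertex a b)) 0 where
  core x := Iff.rfl
  far x _ _ := rfl
  near x _ j _ w _ := by simp

theorem IsCoreLocal.mul {g h : Equiv.Perm (BubbleVertex a b)} {c d : ℤ → ℤ}
    (hg : IsCoreLocal k R g c) (hh : IsCoreLocal k R h d) : IsCoreLocal k R (g * h) (c + d) where
  core x := by rw [Equiv.Perm.mul_apply, hg.core, hh.core]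
  far x hx hj := by rw [Equiv.Perm.mul_apply, hh.far x hx hj, hg.far x hx hj]
  near x hx j hj w hw := by
    have h1 := hh.near x hx j hj w hw
    have h2 : (bubbleAlpha a b ^ j) (h x) = (bubbleBeta a b ^ d j) ((bubbleAlpha a b ^ j) x) := by
      rw [h1, ← Equiv.Perm.mul_apply, ← zpow_add]; simp
    have h3 := hg.near (h x) (by rwa [hh.core]) j hj w
      (by rw [h2]; exact bubbleBeta_zpow_apply_mem hw _)
    rw [Equiv.Perm.mul_apply, h3, h2, Pi.add_apply, zpow_add, Equiv.Perm.mul_apply]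

theorem IsCoreLocal.inv (hR : ∀ m, k ≤ m → 2 * R ≤ (a m : ℕ))
    {h : Equiv.Perm (BubbleVertex a b)} {c : ℤ → ℤ}
    (hh : IsCoreLocal k R h c) : IsCoreLocal k R h⁻¹ (-c) where
  core x := by rw [← hh.core]; exact iff_of_eq (congrArg (· ∈ _) (h.apply_symm_apply x))
  far x hx hj := by rw [Equiv.Perm.inv_eq_iff_eq, hh.far x hx hj]
  near x hx j hj w hw := by
    rw [Equiv.Perm.inv_eq_iff_eq, eq_comm]
    set y := (bubbleAlpha a b ^ (-j)) ((bubbleBeta a b ^ (-c) j) ((bubbleAlpha a b ^ j) x)) with hy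
    have h2 : (bubbleAlpha a b ^ j) y =
        (bubbleBeta a b ^ (-c) j) ((bubbleAlpha a b ^ j) x) := by
      rw [hy, ← Equiv.Perm.mul_apply, ← zpow_add]; simp
    have hyc : y ∉ bubbleCore a b k R := by rwa [hy, conj_apply_mem_core_iff hR hj]
    rw [hh.near y hyc j hj w (by rw [h2]; exact bubbleBeta_zpow_apply_mem hw _), h2]
    simp

theorem IsCoreLocal.conj (hR : ∀ m, k ≤ m → 2 * R ≤ (a m : ℕ)) {A : ℤ} (hA : |A| < R) :
    IsCoreLocal k R (bubbleAlpha a b ^ (-A) * bubbleBeta a b * bubbleAlpha a b ^ A)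
      (Pi.single A 1) where
  core x := by
    have := conj_apply_mem_core_iff (b := b) hR (x := x) hA 1
    rwa [zpow_one] at this
  far x hx hj := by
    rw [Equiv.Perm.mul_apply, Equiv.Perm.mul_apply, bubbleBeta_apply_eq_self (hj A hA)]
    simp
  near x hx j hj w hw := by
    by_cases hjA : j = A
    · subst hjA
      simp
    · rw [Pi.single_eq_of_ne hjA, Equiv.Perm.mul_apply, Equiv.Perm.mul_apply,
        bubbleBeta_apply_eq_self (notMem_bubbleCycle_of_ne hR hx hj hA hjA hw)]
      simp

/-- Outside the core only the exponents of `β` at the rotations `|j| < R` matter, and these only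
modulo `b` because `β ^ b = 1`. -/
theorem IsCoreLocal.ext_of (hb : 2 ≤ b) {g h : Equiv.Perm (BubbleVertex a b)} {c d : ℤ → ℤ}
    (hg : IsCoreLocal k R g c) (hh : IsCoreLocal k R h d)
    (hcore : ∀ x ∈ bubbleCore a b k R, g x = h x)
    (hcd : ∀ j : ℤ, |j| < R → (c j : ZMod b) = d j) : g = h := by
  ext1 x
  by_cases hx : x ∈ bubbleCore a b k R
  · exact hcore x hx
  by_cases hj : ∃ j : ℤ, |j| < R ∧ ∃ w, (bubbleAlpha a b ^ j) x ∈ bubbleCycle a w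
  · obtain ⟨j, hj, w, hw⟩ := hj
    rw [hg.near x hx j hj w hw, hh.near x hx j hj w hw]
    have : bubbleBeta a b ^ c j = bubbleBeta a b ^ d j := by
      obtain ⟨t, ht⟩ := (ZMod.intCast_eq_intCast_iff_dvd_sub _ _ _).1 (hcd j hj)
      rw [show d j = c j + b * t by omega, zpow_add, zpow_mul, zpow_natCast,
        bubbleBeta_pow_eq_one hb, one_zpow, mul_one]
    rw [this]
  · push Not at hj
    rw [hg.far x hx hj, hh.far x hx hj]

/-- The subgroup generated by the conjugates `α ^ (-A) β α ^ A` with `|A| < R`. -/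
def bubbleLocalGroup (a : ℕ → ℕ+) (b R : ℕ) : Subgroup (bubbleGroup a b) :=
  Subgroup.closure {g | ∃ A : ℤ, |A| < R ∧
    g = bubbleGenAlpha a b ^ (-A) * bubbleGenBeta a b * bubbleGenAlpha a b ^ A}

theorem exists_isCoreLocal (hR : ∀ m, k ≤ m → 2 * R ≤ (a m : ℕ)) {g : bubbleGroup a b}
    (hg : g ∈ bubbleLocalGroup a b R) : ∃ c, IsCoreLocal k R g.1 c := by
  induction hg using Subgroup.closure_induction with
  | mem g hg =>
    obtain ⟨A, hA, rfl⟩ := hg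
    exact ⟨_, IsCoreLocal.conj hR hA⟩
  | one => exact ⟨0, IsCoreLocal.one⟩
  | mul g h _ _ hg hh =>
    obtain ⟨c, hc⟩ := hg
    obtain ⟨d, hd⟩ := hh
    exact ⟨_, hc.mul hd⟩
  | inv g _ hg =>
    obtain ⟨c, hc⟩ := hg
    exact ⟨_, hc.inv hR⟩

/-- An element is encoded by its self-map of the core and by its exponents modulo `b`, indexed by
rotations. -/
theorem card_bubbleLocalGroup_le (hb : 2 ≤ b) (hk : 1 ≤ k)
    (hR : ∀ m, k ≤ m → 2 * R ≤ (a m : ℕ)) :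
    Finite (bubbleLocalGroup a b R) ∧ Nat.card (bubbleLocalGroup a b R) ≤
      b ^ (2 * R) * (bubbleCore a b k R).ncard ^ (bubbleCore a b k R).ncard := by
  set Y := bubbleCore a b k R with hY
  have : Finite Y := (bubbleCore_finite k R hk).1
  have : NeZero b := ⟨by omega⟩
  choose c hc using fun g : bubbleLocalGroup a b R => exists_isCoreLocal (k := k) hR g.2
  -- The half-open interval has `2 R` elements and contains every `j` with `|j| < R`; the
  -- superfluous index `-R` is harmless.
  set F : bubbleLocalGroup a b R → (Finset.Ico (-R : ℤ) R → ZMod b) × (Y → Y) := fun g =>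
    (fun j => (c g j : ZMod b), fun y => ⟨(g : bubbleGroup a b).1 y, ((hc g).core y).2 y.2⟩) with hF
  have hinj : Function.Injective F := by
    intro g h hgh
    rw [hF, Prod.mk.injEq] at hgh
    refine Subtype.ext (Subtype.ext ((hc g).ext_of hb (hc h) (fun x hx => ?_) fun j hj => ?_))
    · exact congrArg Subtype.val (congrFun hgh.2 ⟨x, hx⟩)
    · rw [abs_lt] at hj
      exact congrFun hgh.1 ⟨j, by rw [Finset.mem_Ico]; omega⟩
  refine ⟨Finite.of_injective F hinj, (Nat.card_le_card_of_injective F hinj).trans (le_of_eq ?_)⟩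
  rw [Nat.card_prod, Nat.card_fun, Nat.card_fun, Nat.card_coe_set_eq, Nat.card_eq_fintype_card,
    ZMod.card, Nat.card_eq_fintype_card, Fintype.card_coe, Int.card_Ico]
  congr 2
  omega

end Local

theorem exists_lt_scaling (ha : IsScalingSequence a) (N : ℕ) : ∃ n, N < (a (n + 1) : ℕ) := by
  obtain ⟨m, hm⟩ := ((Filter.tendsto_atTop.1 ha.tendsto (N + 1)).and
    (Filter.eventually_ge_atTop 1)).exists
  refine ⟨m - 1, ?_⟩
  rw [Nat.sub_add_cancel hm.2]
  exact hm.1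

theorem eq_zero_of_bubbleAlpha_zpow_eq_one (hb : 2 ≤ b) (ha : IsScalingSequence a) {n : ℤ}
    (h : bubbleAlpha a b ^ n = 1) : n = 0 := by
  obtain ⟨m, hm⟩ := exists_lt_scaling ha n.natAbs
  have h1 := congrArg (fun g : Equiv.Perm (BubbleVertex a b) =>
    g (bubbleStart a (List.replicate m ⟨0, by omega⟩))) h
  simp only [bubbleAlpha_zpow_apply_start, Equiv.Perm.one_apply, mk_eq_bubbleStart_iff,
    ZMod.intCast_zmod_eq_zero_iff_dvd, List.length_replicate] at h1
  refine Int.eq_zero_of_abs_lt_dvd h1 ?_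
  push_cast
  rw [Int.abs_eq_natAbs]
  omega

/-- Elements of a finite group have finite order, whereas `α` has infinite order since the bubbles
are unboundedly long. This makes the decomposition `α ^ A h` unique. -/
theorem eq_zero_of_zpow_mem_bubbleLocalGroup (hb : 2 ≤ b) (ha : IsScalingSequence a) {R : ℕ}
    [Finite (bubbleLocalGroup a b R)] {n : ℤ}
    (h : bubbleGenAlpha a b ^ n ∈ bubbleLocalGroup a b R) : n = 0 := by
  obtain ⟨m, hm, h1⟩ := isOfFinOrder_iff_pow_eq_one.1
    (isOfFinOrder_of_finite (⟨_, h⟩ : bubbleLocalGroup a b R))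
  have h2 : bubbleAlpha a b ^ (n * m) = 1 := by
    have := congrArg (fun g : bubbleLocalGroup a b R => (g : bubbleGroup a b).1) h1
    simpa [zpow_mul, bubbleGenAlpha] using this
  have h3 := eq_zero_of_bubbleAlpha_zpow_eq_one hb ha h2
  have : (m : ℤ) ≠ 0 := by omega
  exact (mul_eq_zero.1 h3).resolve_right this

/-! ### Generators of the wreath product -/

theorem wreathLamp_intCast {X : Type*} {Γ : Subgroup (Equiv.Perm X)} (x : X) (n : ℤ) :
    wreathLamp Γ x n = wreathLamp Γ x 1 ^ n := by
  rcases n.eq_nat_or_neg with ⟨m, rfl | rfl⟩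
  · rw [wreathLamp_natCast, zpow_natCast]
  · rw [zpow_neg, zpow_natCast, ← wreathLamp_natCast, eq_inv_iff_mul_eq_one, ← wreathLamp_add,
      neg_add_cancel, wreathLamp_zero]

/-- The standard generators `α`, `β` and the lamp at the root. -/
theorem closure_bubble_generators (a : ℕ → ℕ+) (b : ℕ) :
    Subgroup.closure ({SemidirectProduct.inr (bubbleGenAlpha a b),
      SemidirectProduct.inr (bubbleGenBeta a b), wreathLamp (bubbleGroup a b) (bubbleRoot a b) 1} :
        Set (ZWreath (bubbleGroup a b))) = ⊤ := by
  set H := Subgroup.closure ({SemidirectProduct.inr (bubbleGenAlpha a b),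
      SemidirectProduct.inr (bubbleGenBeta a b), wreathLamp (bubbleGroup a b) (bubbleRoot a b) 1} :
        Set (ZWreath (bubbleGroup a b))) with hH
  have hmem : ∀ g ∈ ({SemidirectProduct.inr (bubbleGenAlpha a b),
      SemidirectProduct.inr (bubbleGenBeta a b), wreathLamp (bubbleGroup a b) (bubbleRoot a b) 1} :
        Set (ZWreath (bubbleGroup a b))), g ∈ H := fun g hg => Subgroup.subset_closure hg
  have hr : ∀ γ : bubbleGroup a b, SemidirectProduct.inr γ ∈ H := by
    rintro ⟨γ, hγ⟩
    induction hγ using Subgroup.closure_induction with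
    | mem x hx =>
      rcases hx with rfl | rfl
      · exact hmem _ (by left; rfl)
      · exact hmem _ (by right; left; rfl)
    | one => exact H.one_mem
    | mul x y hx hy ihx ihy =>
      have := H.mul_mem ihx ihy
      rwa [← map_mul] at this
    | inv x hx ih =>
      have := H.inv_mem ih
      rwa [← map_inv] at this
  have hlamp : ∀ x n, wreathLamp (bubbleGroup a b) x n ∈ H := by
    intro x n
    obtain ⟨γ, rfl⟩ := exists_bubbleGroup_apply_root x
    rw [wreathLamp_smul, wreathLamp_intCast]
    exact H.mul_mem (H.mul_mem (hr γ) (H.zpow_mem (hmem _ (by simp)) n)) (hr γ⁻¹)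
  have hl : ∀ f : BubbleVertex a b →₀ ℤ,
      (SemidirectProduct.inl (Multiplicative.ofAdd f) : ZWreath (bubbleGroup a b)) ∈ H := by
    intro f
    induction f using Finsupp.induction with
    | zero => rw [ofAdd_zero, map_one]; exact H.one_mem
    | single_add x n f _ _ ih =>
      rw [ofAdd_add, map_mul]
      exact H.mul_mem (hlamp x n) ih
  rw [eq_top_iff]
  rintro g -
  rw [← SemidirectProduct.inl_left_mul_inr_right g]
  exact H.mul_mem (hl (Multiplicative.toAdd g.left)) (hr g.right)

end Bubble

/-! ### Tent functions -/

/-- The tent function `max (R - |n|) 0` on the integers. -/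
noncomputable def tent (R : ℕ) (n : ℤ) : ℝ := max (R - |(n : ℝ)|) 0

theorem tent_eq_zero {R : ℕ} {n : ℤ} (h : ¬ |n| < R) : tent R n = 0 := by
  apply max_eq_right
  have : (R : ℤ) ≤ |n| := not_lt.1 h
  have : (R : ℝ) ≤ |(n : ℝ)| := by exact_mod_cast this
  linarith

theorem tent_zero_pos {R : ℕ} (hR : 1 ≤ R) : 0 < tent R 0 := by
  have : (1 : ℝ) ≤ R := by exact_mod_cast hR
  simp only [tent, Int.cast_zero, abs_zero, sub_zero]
  exact lt_max_of_lt_left (by linarith)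

theorem abs_tent_succ_sub_le (R : ℕ) (n : ℤ) : |tent R (n + 1) - tent R n| ≤ 1 := by
  refine (abs_max_sub_max_le_abs _ _ _).trans ?_
  push_cast
  have := abs_abs_sub_abs_le_abs_sub (n : ℝ) (n + 1)
  rw [show (n : ℝ) - (n + 1) = -1 by ring, abs_neg, abs_one] at this
  rwa [show (R : ℝ) - |(n : ℝ) + 1| - (R - |(n : ℝ)|) = |(n : ℝ)| - |(n : ℝ) + 1| by ring]

/-- There are `2 R` increments of size at most 1, while at least `R / 2` integers carry a value at
least `R / 2`; hence the ratio `2 R / (R³ / 8) = 16 / R²`. -/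
theorem tsum_tent_succ_sub_sq_le {R : ℕ} (hR : 1 ≤ R) :
    ∑' n : ℤ, ENNReal.ofReal ((tent R (n + 1) - tent R n) ^ 2) ≤
      ENNReal.ofReal (16 / R ^ 2) * ∑' n : ℤ, ENNReal.ofReal (tent R n ^ 2) := by
  have hR' : (1 : ℝ) ≤ R := by exact_mod_cast hR
  have h1 : ∑' n : ℤ, ENNReal.ofReal ((tent R (n + 1) - tent R n) ^ 2) ≤
      ENNReal.ofReal (2 * R) := by
    rw [tsum_eq_sum (s := Finset.Ico (-R : ℤ) R)]
    · refine (Finset.sum_le_card_nsmul _ _ 1 fun n _ => ?_).trans ?_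
      · rw [← ENNReal.ofReal_one]
        apply ENNReal.ofReal_le_ofReal
        rw [sq_le_one_iff_abs_le_one]
        exact abs_tent_succ_sub_le R n
      · rw [Int.card_Ico, nsmul_one, ← ENNReal.ofReal_natCast]
        apply ENNReal.ofReal_le_ofReal
        have : ((R : ℤ) - -R).toNat = 2 * R := by omega
        rw [this]; push_cast; exact le_rfl
    · intro n hn
      rw [Finset.mem_Ico, not_and_or] at hn
      rw [tent_eq_zero (R := R) (n := n), tent_eq_zero (R := R) (n := n + 1)]
      · simp
      · rw [abs_lt]; omega
      · rw [abs_lt]; omega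
  have h2 : ENNReal.ofReal (R ^ 3 / 8) ≤ ∑' n : ℤ, ENNReal.ofReal (tent R n ^ 2) := by
    refine le_trans ?_ (ENNReal.sum_le_tsum (Finset.Ico (0 : ℤ) (R / 2 + 1)))
    have hterm : ∀ n ∈ Finset.Ico (0 : ℤ) (R / 2 + 1),
        ENNReal.ofReal (R ^ 2 / 4) ≤ ENNReal.ofReal (tent R n ^ 2) := by
      intro n hn
      apply ENNReal.ofReal_le_ofReal
      rw [Finset.mem_Ico] at hn
      have h3 : 2 * n ≤ R := by omega
      have h3' : 2 * (n : ℝ) ≤ R := by exact_mod_cast h3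
      have h4 : (0 : ℝ) ≤ n := by exact_mod_cast hn.1
      have h5 : (R : ℝ) / 2 ≤ tent R n := by
        refine le_max_of_le_left ?_
        rw [abs_of_nonneg h4]; linarith
      nlinarith
    refine le_trans ?_ (Finset.card_nsmul_le_sum _ _ _ hterm)
    rw [Int.card_Ico, nsmul_eq_mul, ← ENNReal.ofReal_natCast, ← ENNReal.ofReal_mul (by positivity)]
    apply ENNReal.ofReal_le_ofReal
    have h3 : R ≤ 2 * ((R : ℤ) / 2 + 1 - 0).toNat := by omega
    have h3' : (R : ℝ) ≤ 2 * (((R : ℤ) / 2 + 1 - 0).toNat : ℝ) := by exact_mod_cast h3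
    nlinarith [sq_nonneg (R : ℝ)]
  refine h1.trans (le_trans ?_ (mul_le_mul_right h2 _))
  rw [← ENNReal.ofReal_mul (by positivity)]
  apply ENNReal.ofReal_le_ofReal
  have : 16 / (R : ℝ) ^ 2 * (R ^ 3 / 8) = 2 * R := by field_simp; ring
  rw [this]

/-- The product of tent functions over all coordinates. -/
noncomputable def tentProd {ι : Type*} [Fintype ι] (R : ℕ) (f : ι → ℤ) : ℝ := ∏ i, tent R (f i)

/-- Fubini isolates the coordinate `i`, the other factors being common to both sides. The constant
does not depend on the number of coordinates. -/
theorem tsum_tentProd_add_single_sub_sq_le {ι : Type*} [Fintype ι] [DecidableEq ι] {R : ℕ}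
    (hR : 1 ≤ R) (i : ι) :
    ∑' f : ι → ℤ, ENNReal.ofReal ((tentProd R (f + Pi.single i 1) - tentProd R f) ^ 2) ≤
      ENNReal.ofReal (16 / R ^ 2) * ∑' f : ι → ℤ, ENNReal.ofReal (tentProd R f ^ 2) := by
  rw [← (Equiv.funSplitAt i ℤ).symm.tsum_eq, ← (Equiv.funSplitAt i ℤ).symm.tsum_eq
    (fun f => ENNReal.ofReal (tentProd R f ^ 2))]
  have h0 : ∀ p : ℤ × ({j // j ≠ i} → ℤ), tentProd R ((Equiv.funSplitAt i ℤ).symm p) =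
      tent R p.1 * tentProd R p.2 := by
    intro p
    unfold tentProd
    rw [Fintype.prod_eq_mul_prod_subtype_ne _ i]
    congr 1
    · simp [Equiv.funSplitAt]
    · refine Finset.prod_congr rfl fun j _ => ?_
      simp [Equiv.funSplitAt, j.2]
  have h1 : ∀ p : ℤ × ({j // j ≠ i} → ℤ), tentProd R ((Equiv.funSplitAt i ℤ).symm p +
      Pi.single i 1) = tent R (p.1 + 1) * tentProd R p.2 := by
    intro p
    rw [← h0 (p.1 + 1, p.2)]
    congr 1
    ext j
    by_cases h : j = i
    · subst h; simp [Equiv.funSplitAt]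
    · simp [Equiv.funSplitAt, h]
  simp_rw [h0, h1, ← sub_mul, mul_pow, ENNReal.ofReal_mul (sq_nonneg _)]
  rw [ENNReal.tsum_prod', ENNReal.tsum_prod']
  simp only [ENNReal.tsum_mul_left, ENNReal.tsum_mul_right]
  rw [← mul_assoc]
  exact mul_le_mul_left (tsum_tent_succ_sub_sq_le hR) _

/-! ### The test function -/

section TestFunction

variable {a : ℕ → ℕ+} {b : ℕ}

/-- Extension by zero of a lamp configuration. -/
noncomputable def extendLamps {X : Type*} {Y : Set X} [Finite Y] (f : Y → ℤ) : X →₀ ℤ :=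
  Finsupp.mapDomain Subtype.val (Finsupp.equivFunOnFinite.symm f)

theorem extendLamps_injective {X : Type*} {Y : Set X} [Finite Y] :
    Function.Injective (extendLamps (Y := Y)) :=
  (Finsupp.mapDomain_injective Subtype.val_injective).comp Finsupp.equivFunOnFinite.symm.injective

theorem extendLamps_add_single {X : Type*} {Y : Set X} [Finite Y] [DecidableEq Y] (f : Y → ℤ)
    (y : Y) (n : ℤ) :
    extendLamps (f + Pi.single y n) = extendLamps f + Finsupp.single (y : X) n := by
  have : Finsupp.equivFunOnFinite.symm (f + Pi.single y n) =
      Finsupp.equivFunOnFinite.symm f + Finsupp.single y n := by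
    ext z
    simp [Finsupp.single_apply, Pi.single_apply, eq_comm]
  rw [extendLamps, this, Finsupp.mapDomain_add, Finsupp.mapDomain_single]
  rfl

/-- The parametrisation `(A, h, f) ↦ α ^ A h f` of a part of the wreath product. -/
noncomputable def bubbleChart {Y : Set (BubbleVertex a b)} [Finite Y] {R : ℕ}
    (p : ℤ × bubbleLocalGroup a b R × (Y → ℤ)) : ZWreath (bubbleGroup a b) :=
  SemidirectProduct.inr (bubbleGenAlpha a b ^ p.1 * p.2.1) *
    SemidirectProduct.inl (Multiplicative.ofAdd (extendLamps p.2.2))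

variable {Y : Set (BubbleVertex a b)} {R : ℕ}

theorem bubbleChart_injective [Finite Y] (hb : 2 ≤ b) (ha : IsScalingSequence a)
    [Finite (bubbleLocalGroup a b R)] :
    Function.Injective (bubbleChart (Y := Y) (R := R)) := by
  rintro ⟨A, h, f⟩ ⟨A', h', f'⟩ heq
  simp only [bubbleChart] at heq
  have h1 := congrArg (fun g => SemidirectProduct.rightHom g) heq
  simp only [map_mul, SemidirectProduct.rightHom_inr, SemidirectProduct.rightHom_inl, mul_one] at h1
  have h1' : bubbleGenAlpha a b ^ A * (h : bubbleGroup a b) = bubbleGenAlpha a b ^ A' * h' := h1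
  have h2 : bubbleGenAlpha a b ^ (-A' + A) = (h' * h⁻¹ : bubbleLocalGroup a b R) := by
    rw [zpow_add, zpow_neg, inv_mul_eq_iff_eq_mul]
    push_cast
    rw [← mul_assoc, eq_mul_inv_iff_mul_eq, h1']
  have h3 := eq_zero_of_zpow_mem_bubbleLocalGroup hb ha (R := R) (n := -A' + A)
    (by rw [h2]; exact (h' * h⁻¹).2)
  obtain rfl : A = A' := by omega
  obtain rfl : h = h' := Subtype.ext (mul_left_cancel h1')
  have h4 := SemidirectProduct.inl_injective (mul_left_cancel heq)
  obtain rfl : f = f' := extendLamps_injective (Multiplicative.ofAdd.injective h4)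
  rfl

theorem inr_alpha_mul_bubbleChart [Finite Y] (p : ℤ × bubbleLocalGroup a b R × (Y → ℤ)) :
    SemidirectProduct.inr (bubbleGenAlpha a b) * bubbleChart p = bubbleChart (p.1 + 1, p.2) := by
  simp only [bubbleChart]
  rw [← mul_assoc, ← map_mul, ← mul_assoc, ← zpow_one_add, add_comm]

/-- Indeed `β α ^ A = α ^ A (α ^ (-A) β α ^ A)`, and the bracket is a generator of the local group
exactly when `|A| < R`, up to coincidences of conjugates. -/
theorem inr_beta_mul_bubbleChart [Finite Y] {A : ℤ} (hA : |A| < R) :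
    ∃ σ : bubbleLocalGroup a b R, ∀ p : bubbleLocalGroup a b R × (Y → ℤ),
      SemidirectProduct.inr (bubbleGenBeta a b) * bubbleChart (A, p) =
        bubbleChart (A, σ * p.1, p.2) := by
  refine ⟨⟨bubbleGenAlpha a b ^ (-A) * bubbleGenBeta a b * bubbleGenAlpha a b ^ A,
    Subgroup.subset_closure ⟨A, hA, rfl⟩⟩, fun p => ?_⟩
  simp only [bubbleChart]
  rw [← mul_assoc, ← map_mul]
  congr 2
  push_cast
  group

theorem lamp_mul_bubbleChart [Finite Y] [DecidableEq Y] {A : ℤ} {h : bubbleLocalGroup a b R}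
    {y : Y} (hy : ((bubbleGenAlpha a b ^ A * h : bubbleGroup a b) : Equiv.Perm (BubbleVertex a b)) y =
      bubbleRoot a b) (n : ℤ) (f : Y → ℤ) :
    wreathLamp (bubbleGroup a b) (bubbleRoot a b) n * bubbleChart (A, h, f) =
      bubbleChart (A, h, f + Pi.single y n) := by
  simp only [bubbleChart]
  rw [← hy, wreathLamp_smul, extendLamps_add_single]
  generalize bubbleGenAlpha a b ^ A * (h : bubbleGroup a b) = γ
  rw [ofAdd_add, map_inv, mul_assoc, inv_mul_cancel_left, mul_assoc, mul_right_inj, wreathLamp,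
    ← map_mul, mul_comm]

/-- The preimage of the root under `α ^ A` is at distance `|A| < R` from the origin of the first
bubble, hence in the core, which `h` preserves. So the root lamp acts on the chart by shifting a
coordinate indexed by the core. -/
theorem exists_mem_core_apply_eq_root {k : ℕ} (hk : 1 ≤ k) (hR : ∀ m, k ≤ m → 2 * R ≤ (a m : ℕ))
    {A : ℤ} (hA : |A| < R) (h : bubbleLocalGroup a b R) :
    ∃ y : bubbleCore a b k R, ((bubbleGenAlpha a b ^ A * h : bubbleGroup a b) :
      Equiv.Perm (BubbleVertex a b)) y = bubbleRoot a b := by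
  obtain ⟨c, hc⟩ := exists_isCoreLocal (k := k) hR h.2
  set γ := (bubbleGenAlpha a b ^ A * h : bubbleGroup a b) with hγ
  set y := (γ : Equiv.Perm (BubbleVertex a b)).symm (bubbleRoot a b) with hy
  refine ⟨⟨y, (hc.core y).1 ?_⟩, Equiv.apply_symm_apply _ _⟩
  have h1 : (bubbleAlpha a b ^ A) ((h : bubbleGroup a b).1 y) = bubbleStart a [] :=
    Equiv.apply_symm_apply (γ : Equiv.Perm (BubbleVertex a b)) (bubbleRoot a b)
  have h2 : (h : bubbleGroup a b).1 y = (bubbleAlpha a b ^ (-A)) (bubbleStart a []) := by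
    rw [← h1, zpow_neg]; exact ((bubbleAlpha a b ^ A).symm_apply_apply _).symm
  rw [h2]
  rcases hk.eq_or_lt with rfl | hk
  · exact Or.inr ⟨[], -A, rfl, by rwa [abs_neg], rfl⟩
  · left
    rw [bubbleAlpha_zpow_apply]
    exact hk

/-- A tent function in the coordinates of `bubbleChart`. -/
noncomputable def bubbleTent [Fintype Y] (p : ℤ × bubbleLocalGroup a b R × (Y → ℤ)) : ℝ :=
  tent R p.1 * tentProd R p.2.2

/-- The test function on the wreath product. -/
noncomputable def bubbleTest (Y : Set (BubbleVertex a b)) [Fintype Y] (R : ℕ) :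
    ZWreath (bubbleGroup a b) → ℝ :=
  Function.extend (bubbleChart (Y := Y) (R := R)) bubbleTent 0

theorem exists_eq_bubbleChart_of_ne_zero [Fintype Y] (he : Function.Injective (bubbleChart (Y := Y) (R := R)))
    {g : ZWreath (bubbleGroup a b)} (hg : bubbleTest Y R g ≠ 0) :
    ∃ p : ℤ × bubbleLocalGroup a b R × (Y → ℤ), |p.1| < R ∧ (∀ y, |p.2.2 y| < R) ∧
      g = bubbleChart p := by
  by_cases h : ∃ p, bubbleChart (Y := Y) (R := R) p = g
  · obtain ⟨p, rfl⟩ := h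
    rw [bubbleTest, he.extend_apply] at hg
    refine ⟨p, ?_, fun y => ?_, rfl⟩
    · by_contra h
      exact left_ne_zero_of_mul hg (tent_eq_zero h)
    · by_contra h
      exact Finset.prod_ne_zero_iff.1 (right_ne_zero_of_mul hg) y (Finset.mem_univ _) (tent_eq_zero h)
  · exact absurd (Function.extend_apply' _ _ _ h) hg

/-! ### Energy and support of the test function. -/

theorem displacement_bubbleTest [Fintype Y]
    (he : Function.Injective (bubbleChart (Y := Y) (R := R)))
    (s : ZWreath (bubbleGroup a b))
    (hs : ∀ g, bubbleTest Y R (s * g) ≠ 0 → g ∈ Set.range (bubbleChart (Y := Y) (R := R))) :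
    displacement 2 (bubbleTest Y R) s =
      ∑' p : ℤ × bubbleLocalGroup a b R × (Y → ℤ),
        ENNReal.ofReal ((bubbleTest Y R (s * bubbleChart p) - bubbleTent p) ^ 2) := by
  unfold displacement
  simp only [sq_abs]
  rw [← he.tsum_eq]
  · refine tsum_congr fun p => ?_
    rw [show bubbleTest Y R (bubbleChart p) = bubbleTent p from he.extend_apply _ _ _]
  · intro g hg
    by_contra h
    refine hg ?_
    have h1 : bubbleTest Y R g = 0 := Function.extend_apply' _ _ _ h
    have h2 : bubbleTest Y R (s * g) = 0 := by
      by_contra h2; exact h (hs g h2)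
    simp [h1, h2]

theorem tsum_bubbleTent_sq [Fintype Y] :
    ∑' p : ℤ × bubbleLocalGroup a b R × (Y → ℤ), ENNReal.ofReal (bubbleTent p ^ 2) =
      ∑' A : ℤ, ∑' _h : bubbleLocalGroup a b R,
        ENNReal.ofReal (tent R A ^ 2) * ∑' f : Y → ℤ, ENNReal.ofReal (tentProd R f ^ 2) := by
  rw [ENNReal.tsum_prod']
  refine tsum_congr fun A => ?_
  rw [ENNReal.tsum_prod']
  refine tsum_congr fun h => ?_
  simp_rw [bubbleTent, mul_pow, ENNReal.ofReal_mul (sq_nonneg _)]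
  rw [ENNReal.tsum_mul_left]

theorem displacement_bubbleTest_alpha_le [Fintype Y] (hR1 : 1 ≤ R)
    (he : Function.Injective (bubbleChart (Y := Y) (R := R))) :
    displacement 2 (bubbleTest Y R) (SemidirectProduct.inr (bubbleGenAlpha a b)) ≤
      ENNReal.ofReal (16 / R ^ 2) *
        ∑' p : ℤ × bubbleLocalGroup a b R × (Y → ℤ), ENNReal.ofReal (bubbleTent p ^ 2) := by
  rw [displacement_bubbleTest he]
  · rw [tsum_bubbleTent_sq, ENNReal.tsum_comm, ENNReal.tsum_prod', ← ENNReal.tsum_mul_left]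
    simp_rw [ENNReal.tsum_prod' (α := bubbleLocalGroup a b R), inr_alpha_mul_bubbleChart]
    rw [ENNReal.tsum_comm]
    refine ENNReal.tsum_le_tsum fun h => ?_
    rw [ENNReal.tsum_mul_right, ← mul_assoc]
    refine le_trans (le_of_eq ?_) (mul_le_mul_left (tsum_tent_succ_sub_sq_le hR1) _)
    rw [← ENNReal.tsum_mul_right]
    refine tsum_congr fun A => ?_
    rw [← ENNReal.tsum_mul_left]
    refine tsum_congr fun f => ?_
    rw [show bubbleTest Y R (bubbleChart (A + 1, h, f)) = bubbleTent (A + 1, h, f) from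
      he.extend_apply _ _ _, ← ENNReal.ofReal_mul (sq_nonneg _), ← mul_pow]
    simp only [bubbleTent]
    rw [sub_mul]
  · intro g hg
    obtain ⟨p, -, -, hp⟩ := exists_eq_bubbleChart_of_ne_zero he hg
    refine ⟨(p.1 - 1, p.2), ?_⟩
    have := inr_alpha_mul_bubbleChart (p.1 - 1, p.2)
    rw [sub_add_cancel, ← hp] at this
    exact mul_left_cancel this

/-- On the part `|A| < R` of the chart, left multiplication by `β` only changes `h`, on which the
test function does not depend. -/
theorem displacement_bubbleTest_beta [Fintype Y]
    (he : Function.Injective (bubbleChart (Y := Y) (R := R))) :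
    displacement 2 (bubbleTest Y R) (SemidirectProduct.inr (bubbleGenBeta a b)) = 0 := by
  have hinv : ∀ p : ℤ × bubbleLocalGroup a b R × (Y → ℤ), |p.1| < R →
      bubbleTest Y R (SemidirectProduct.inr (bubbleGenBeta a b) * bubbleChart p) =
        bubbleTest Y R (bubbleChart p) := by
    rintro ⟨A, p⟩ hA
    obtain ⟨σ, hσ⟩ := inr_beta_mul_bubbleChart (Y := Y) hA
    rw [hσ, bubbleTest, he.extend_apply, he.extend_apply]
    rfl
  have hall : ∀ g, bubbleTest Y R (SemidirectProduct.inr (bubbleGenBeta a b) * g) =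
      bubbleTest Y R g := by
    intro g
    by_cases h1 : bubbleTest Y R g = 0
    · by_cases h2 : bubbleTest Y R (SemidirectProduct.inr (bubbleGenBeta a b) * g) = 0
      · rw [h1, h2]
      · obtain ⟨⟨A, h, f⟩, hA, -, hp⟩ := exists_eq_bubbleChart_of_ne_zero he h2
        obtain ⟨σ, hσ⟩ := inr_beta_mul_bubbleChart (Y := Y) hA
        have h3 := hσ (σ⁻¹ * h, f)
        simp only [mul_inv_cancel_left] at h3
        rw [← hp] at h3
        rw [← mul_left_cancel h3]
        exact hinv _ hA
    · obtain ⟨p, hp1, -, rfl⟩ := exists_eq_bubbleChart_of_ne_zero he h1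
      exact hinv p hp1
  simp [displacement, hall]

theorem displacement_bubbleTest_lamp_le {k : ℕ} [Fintype (bubbleCore a b k R)] (hk : 1 ≤ k)
    (hR : ∀ m, k ≤ m → 2 * R ≤ (a m : ℕ)) (hR1 : 1 ≤ R)
    (he : Function.Injective (bubbleChart (Y := bubbleCore a b k R) (R := R))) :
    displacement 2 (bubbleTest (bubbleCore a b k R) R)
        (wreathLamp (bubbleGroup a b) (bubbleRoot a b) 1) ≤
      ENNReal.ofReal (16 / R ^ 2) *
        ∑' p : ℤ × bubbleLocalGroup a b R × (bubbleCore a b k R → ℤ),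
          ENNReal.ofReal (bubbleTent p ^ 2) := by
  classical
  have hback : ∀ g, bubbleTest (bubbleCore a b k R) R
      (wreathLamp (bubbleGroup a b) (bubbleRoot a b) 1 * g) ≠ 0 →
      ∃ p : ℤ × bubbleLocalGroup a b R × (bubbleCore a b k R → ℤ),
        |p.1| < R ∧ g = bubbleChart p := by
    intro g hg
    obtain ⟨⟨A, h, f⟩, hA, -, hp⟩ := exists_eq_bubbleChart_of_ne_zero he hg
    obtain ⟨y, hy⟩ := exists_mem_core_apply_eq_root hk hR hA h
    refine ⟨(A, h, f + Pi.single y (-1)), hA, ?_⟩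
    have h1 := lamp_mul_bubbleChart hy 1 (f + Pi.single y (-1))
    rw [add_assoc, ← Pi.single_add, neg_add_cancel, Pi.single_zero, add_zero, ← hp] at h1
    exact (mul_left_cancel h1).symm
  rw [displacement_bubbleTest he]
  · rw [tsum_bubbleTent_sq, ENNReal.tsum_prod', ← ENNReal.tsum_mul_left]
    refine ENNReal.tsum_le_tsum fun A => ?_
    rw [ENNReal.tsum_prod', ← ENNReal.tsum_mul_left]
    refine ENNReal.tsum_le_tsum fun h => ?_
    by_cases hA : |A| < R
    · obtain ⟨y, hy⟩ := exists_mem_core_apply_eq_root hk hR hA h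
      rw [mul_left_comm]
      refine le_trans (le_of_eq ?_)
        (mul_le_mul_right (tsum_tentProd_add_single_sub_sq_le hR1 y) _)
      rw [← ENNReal.tsum_mul_left]
      refine tsum_congr fun f => ?_
      rw [lamp_mul_bubbleChart hy, bubbleTest, he.extend_apply,
        ← ENNReal.ofReal_mul (sq_nonneg _), ← mul_pow]
      simp only [bubbleTent]
      rw [mul_sub]
    · refine le_trans (le_of_eq ?_) zero_le
      rw [ENNReal.tsum_eq_zero]
      intro f
      have h1 : bubbleTest (bubbleCore a b k R) R
          (wreathLamp (bubbleGroup a b) (bubbleRoot a b) 1 * bubbleChart (A, h, f)) = 0 := by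
        by_contra h1
        obtain ⟨p, hp, hp'⟩ := hback _ h1
        rw [← he hp'] at hp
        exact hA hp
      rw [h1, bubbleTent, tent_eq_zero hA]
      simp
  · intro g hg
    obtain ⟨p, -, rfl⟩ := hback g hg
    exact ⟨p, rfl⟩

theorem support_bubbleTest [Fintype Y] [Finite (bubbleLocalGroup a b R)]
    (he : Function.Injective (bubbleChart (Y := Y) (R := R))) :
    (Function.support (bubbleTest Y R)).Finite ∧ (Function.support (bubbleTest Y R)).ncard ≤
      2 * R * (Nat.card (bubbleLocalGroup a b R) * (2 * R) ^ Y.ncard) := by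
  classical
  have : Fintype (bubbleLocalGroup a b R) := Fintype.ofFinite _
  set D : Finset (ℤ × bubbleLocalGroup a b R × (Y → ℤ)) := Finset.Ico (-R : ℤ) R ×ˢ
    (Finset.univ ×ˢ Fintype.piFinset fun _ => Finset.Ico (-R : ℤ) R) with hD
  have hsub : Function.support (bubbleTest Y R) ⊆ (D.image bubbleChart : Finset _) := by
    intro g hg
    obtain ⟨p, hp1, hp2, rfl⟩ := exists_eq_bubbleChart_of_ne_zero he hg
    refine Finset.mem_coe.2 (Finset.mem_image_of_mem _ ?_)
    simp only [hD, Finset.mem_product, Finset.mem_univ, Fintype.mem_piFinset, Finset.mem_Ico, true_and]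
    refine ⟨?_, fun y => ?_⟩
    · rw [abs_lt] at hp1; omega
    · have := hp2 y
      rw [abs_lt] at this; omega
  refine ⟨(Finset.finite_toSet _).subset hsub, ?_⟩
  refine (Set.ncard_le_ncard hsub (Finset.finite_toSet _)).trans ?_
  rw [Set.ncard_coe_finset]
  refine Finset.card_image_le.trans (le_of_eq ?_)
  rw [hD, Finset.card_product, Finset.card_product, Fintype.card_piFinset, Finset.prod_const,
    Finset.card_univ, Finset.card_univ, Int.card_Ico, Nat.card_eq_fintype_card,
    ← Nat.card_coe_set_eq, Nat.card_eq_fintype_card]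
  rw [show ((R : ℤ) - -R).toNat = 2 * R by omega]

theorem exists_profileTwo_le_of_core (hb : 2 ≤ b) (ha : IsScalingSequence a)
    {φ : PMF (ZWreath (bubbleGroup a b))} (hφ : φ.support.Finite) :
    ∃ K : ℝ, 0 ≤ K ∧ ∀ k R : ℕ, 1 ≤ k → 1 ≤ R → (∀ m, k ≤ m → 2 * R ≤ (a m : ℕ)) → ∀ v : ℝ,
      ((2 * R * (b ^ (2 * R) * (bubbleCore a b k R).ncard ^ (bubbleCore a b k R).ncard *
        (2 * R) ^ (bubbleCore a b k R).ncard) : ℕ) : ℝ) ≤ v →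
      profileTwo φ v ≤ ENNReal.ofReal (K / R ^ 2) := by
  classical
  set S : Finset (ZWreath (bubbleGroup a b)) := {SemidirectProduct.inr (bubbleGenAlpha a b),
      SemidirectProduct.inr (bubbleGenBeta a b),
      wreathLamp (bubbleGroup a b) (bubbleRoot a b) 1} with hS
  have hgen : Subgroup.closure (S : Set (ZWreath (bubbleGroup a b))) = ⊤ := by
    rw [hS, ← closure_bubble_generators a b]
    push_cast
    rfl
  obtain ⟨K, hK, hE⟩ := exists_walkEnergy_two_le hφ hgen
  -- Three generators, each contributing at most `16 / R²`.
  refine ⟨K * 48, by positivity, fun k R hk hR1 hR v hv => ?_⟩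
  obtain ⟨hfinH, hcardH⟩ := card_bubbleLocalGroup_le (b := b) hb hk hR
  have hYfin : Finite (bubbleCore a b k R) := (bubbleCore_finite k R hk).1
  have : Fintype (bubbleCore a b k R) := Fintype.ofFinite _
  set Y := bubbleCore a b k R with hY
  have he : Function.Injective (bubbleChart (Y := Y) (R := R)) := bubbleChart_injective hb ha
  obtain ⟨hfin, hcard⟩ := support_bubbleTest he
  set f : ZWreath (bubbleGroup a b) →₀ ℝ := Finsupp.ofSupportFinite (bubbleTest Y R) hfin with hf
  have hff : (f : ZWreath (bubbleGroup a b) → ℝ) = bubbleTest Y R := rfl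
  have hsupp : f.support.card = (Function.support (bubbleTest Y R)).ncard := by
    rw [← Set.ncard_coe_finset, ← Finsupp.fun_support_eq, hff]
  have hnorm : ∑' p : ℤ × bubbleLocalGroup a b R × (Y → ℤ), ENNReal.ofReal (bubbleTent p ^ 2) =
      ENNReal.ofReal (∑ x ∈ f.support, f x ^ 2) := by
    rw [ENNReal.ofReal_sum_of_nonneg fun _ _ => sq_nonneg _]
    rw [← tsum_eq_sum (f := fun x => ENNReal.ofReal (f x ^ 2)) (s := f.support)
      (L := SummationFilter.unconditional _)]
    · rw [← he.tsum_eq]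
      · refine tsum_congr fun p => ?_
        rw [hff, bubbleTest, he.extend_apply]
      · intro g hg
        by_contra h
        refine hg ?_
        have h1 : bubbleTest Y R g = 0 := Function.extend_apply' _ _ _ h
        simp [hff, h1]
    · intro x hx
      simp [Finsupp.notMem_support_iff.1 hx]
  refine profileTwo_le_of_walkEnergy_le (f := f) ?_ ?_ ?_
  · refine le_trans ?_ hv
    rw [hsupp]
    exact_mod_cast hcard.trans (Nat.mul_le_mul_left _ (Nat.mul_le_mul_right _ hcardH))
  · intro h0
    have h1 : f (bubbleChart (0, 1, 0)) = tent R 0 * tentProd R (0 : Y → ℤ) := he.extend_apply _ _ _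
    rw [h0] at h1
    have h2 : 0 < tent R 0 * tentProd R (0 : Y → ℤ) :=
      mul_pos (tent_zero_pos hR1) (Finset.prod_pos fun i _ => tent_zero_pos hR1)
    rw [← h1] at h2
    simp at h2
  · refine (hE f).trans ?_
    have hsum : ∑ s ∈ S, displacement 2 f s ≤
        3 * ENNReal.ofReal (16 / R ^ 2 * ∑ x ∈ f.support, f x ^ 2) := by
      rw [ENNReal.ofReal_mul (by positivity), ← hnorm, hff]
      refine (Finset.sum_le_card_nsmul S _ (ENNReal.ofReal (16 / R ^ 2) *
        ∑' p : ℤ × bubbleLocalGroup a b R × (Y → ℤ), ENNReal.ofReal (bubbleTent p ^ 2))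
        fun s hs => ?_).trans ?_
      · rw [hS] at hs
        simp only [Finset.mem_insert, Finset.mem_singleton] at hs
        rcases hs with rfl | rfl | rfl
        · exact displacement_bubbleTest_alpha_le hR1 he
        · rw [displacement_bubbleTest_beta he]; exact zero_le
        · exact displacement_bubbleTest_lamp_le hk hR hR1 he
      · rw [nsmul_eq_mul]
        refine mul_le_mul_left ?_ _
        exact_mod_cast Finset.card_le_three
    refine (mul_le_mul_right hsum _).trans ?_
    rw [show (3 : ℝ≥0∞) = ENNReal.ofReal 3 by simp, ← ENNReal.ofReal_mul (by norm_num),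
      ← ENNReal.ofReal_mul hK]
    apply ENNReal.ofReal_le_ofReal
    apply le_of_eq
    ring

end TestFunction

section Bounds

variable {a : ℕ → ℕ+} {b : ℕ}

/-! ### The upper bound for the `L²`-profile -/

theorem bubbleIndex_spec (ha : IsScalingSequence a) (r : ℝ) :
    1 ≤ bubbleIndex a r ∧ 2 * r < ((a (bubbleIndex a r) : ℕ) : ℝ) := by
  refine Nat.sInf_mem (s := {k : ℕ | 1 ≤ k ∧ 2 * r < ((a k : ℕ) : ℝ)}) ?_
  obtain ⟨n, hn⟩ := exists_lt_scaling ha ⌈2 * r⌉₊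
  refine ⟨n + 1, by omega, (Nat.le_ceil _).trans_lt ?_⟩
  exact_mod_cast hn

theorem scaling_le_of_lt_bubbleIndex {r : ℝ} {j : ℕ} (hj : 1 ≤ j) (h : j < bubbleIndex a r) :
    ((a j : ℕ) : ℝ) ≤ 2 * r := by
  by_contra hlt
  exact Nat.notMem_of_lt_sInf h ⟨hj, not_le.1 hlt⟩

theorem bubbleIndex_mono (ha : IsScalingSequence a) {r t : ℝ} (h : r ≤ t) :
    bubbleIndex a r ≤ bubbleIndex a t := by
  obtain ⟨h1, h2⟩ := bubbleIndex_spec ha t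
  exact Nat.sInf_le ⟨h1, by linarith⟩

theorem pow_self_le_factorial (m : ℕ) : m ^ m ≤ (2 * m).factorial := by
  rw [two_mul]
  refine le_trans ?_ Nat.factorial_mul_pow_le_factorial
  exact (Nat.pow_le_pow_left (Nat.le_succ m) m).trans
    (Nat.le_mul_of_pos_left _ (Nat.factorial_pos m))

/-- With `m = 4 b n`, each of the four factors is at most `m ^ n`, so the product is at most `m ^ m
≤ (2 m)!`. Here `t = 2 R` and `y` is the size of the core. -/
theorem mul_pow_le_factorial {b n y t : ℕ} (hb : 1 ≤ b) (hn : 1 ≤ n) (hy : y ≤ n) (ht : t ≤ n) :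
    t * (b ^ t * y ^ y * t ^ y) ≤ (8 * b * n).factorial := by
  have hbn : n ≤ b * n := Nat.le_mul_of_pos_left n hb
  have hbb : b ≤ b * n := Nat.le_mul_of_pos_right b hn
  set m := 4 * (b * n) with hm
  have hm1 : 1 ≤ m := by omega
  calc t * (b ^ t * y ^ y * t ^ y) ≤ m ^ n * (m ^ n * m ^ n * m ^ n) := by
        have h1 : t ≤ m ^ n := by
          refine (by omega : t ≤ m).trans ?_
          exact Nat.le_self_pow (by omega) m
        have h2 : ∀ u e : ℕ, u ≤ m → e ≤ n → u ^ e ≤ m ^ n := fun u e hu he =>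
          (Nat.pow_le_pow_left hu e).trans (Nat.pow_le_pow_right hm1 he)
        exact Nat.mul_le_mul h1 (Nat.mul_le_mul (Nat.mul_le_mul (h2 _ _ (by omega) ht)
          (h2 _ _ (by omega) hy)) (h2 _ _ (by omega) hy))
    _ = m ^ (4 * n) := by ring
    _ ≤ m ^ m := Nat.pow_le_pow_right hm1 (by omega)
    _ ≤ (2 * m).factorial := pow_self_le_factorial m
    _ = (8 * b * n).factorial := by congr 1; rw [hm]; ring

theorem le_bubbleSize (hb : 2 ≤ b) {r : ℝ} (hr : 0 ≤ r) :
    ((bubbleLevels a b (bubbleIndex a r - 1)).ncard : ℝ) ≤ bubbleSize a b r ∧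
      ((b : ℝ) - 1) ^ bubbleIndex a r * r / 2 ≤ bubbleSize a b r ∧ r / 2 ≤ bubbleSize a b r := by
  have hb' : (1 : ℝ) ≤ (b : ℝ) - 1 := by
    have : (2 : ℝ) ≤ b := by exact_mod_cast hb
    linarith
  have h1 : 1 ≤ ((b : ℝ) - 1) ^ bubbleIndex a r := one_le_pow₀ hb'
  have h2 : (0 : ℝ) ≤ (bubbleLevels a b (bubbleIndex a r - 1)).ncard := Nat.cast_nonneg _
  have h3 : r ≤ ((b : ℝ) - 1) ^ bubbleIndex a r * r := le_mul_of_one_le_left hr h1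
  unfold bubbleSize
  refine ⟨by linarith, by linarith, by linarith⟩

theorem exists_profileTwo_le (hb : 2 ≤ b) (ha : IsScalingSequence a)
    {φ : PMF (ZWreath (bubbleGroup a b))} (hφ : φ.support.Finite) :
    ∃ D : ℝ, 1 ≤ D ∧ ∀ r : ℝ, 1 < r → ∀ v : ℝ,
      ((⌊D * bubbleSize a b r⌋₊.factorial : ℕ) : ℝ) ≤ v →
        profileTwo φ v ≤ ENNReal.ofReal (D / r ^ 2) := by
  obtain ⟨K, hK, hmain⟩ := exists_profileTwo_le_of_core hb ha hφ
  refine ⟨4 * K + 32 * b + 1, by linarith [(Nat.cast_nonneg b : (0 : ℝ) ≤ b)], fun r hr v hv => ?_⟩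
  -- The term `32 b = 8 b · 4` turns `(8 b n)!` with `n ≤ 4 N` into `(D N)!`; the term `4 K` pays
  -- for `r² ≤ 4 R²`.
  set D := 4 * K + 32 * b + 1 with hD
  obtain ⟨hk1, hk2⟩ := bubbleIndex_spec ha r
  set k := bubbleIndex a r with hk
  set N := bubbleSize a b r with hN
  obtain ⟨hN1, hN2, hN3⟩ := le_bubbleSize (a := a) hb (r := r) (by linarith)
  rw [← hN, ← hk] at hN1 hN2
  rw [← hN] at hN3
  set R := ⌊r⌋₊ with hR
  have hR1 : 1 ≤ R := Nat.one_le_floor_iff r |>.2 hr.le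
  have hRr : (R : ℝ) ≤ r := Nat.floor_le (by linarith)
  have hrR : r ≤ 2 * R := by
    have h1 := Nat.lt_floor_add_one r
    have h2 : (1 : ℝ) ≤ R := by exact_mod_cast hR1
    linarith
  have hRa : ∀ m, k ≤ m → 2 * R ≤ (a m : ℕ) := by
    intro m hm
    have h1 : (a k : ℕ) ≤ a m := ha.mono k m hk1 hm
    have h2 : (2 : ℝ) * R < (a k : ℕ) := by linarith
    have h3 : 2 * R < (a k : ℕ) := by exact_mod_cast h2
    omega
  set n := ⌊4 * N⌋₊ with hn
  have hb1 : ((b - 1 : ℕ) : ℝ) = (b : ℝ) - 1 := by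
    rw [Nat.cast_sub (by omega)]; simp
  have hb' : (1 : ℝ) ≤ (b : ℝ) - 1 := by
    have : (2 : ℝ) ≤ b := by exact_mod_cast hb
    linarith
  have hY : (bubbleCore a b k R).ncard ≤ n := by
    refine (bubbleCore_finite k R hk1).2.trans (Nat.le_floor ?_)
    push_cast
    rw [hb1]
    have h1 : ((b : ℝ) - 1) ^ (k - 1) * (2 * R) ≤ ((b : ℝ) - 1) ^ k * (2 * r) := by
      gcongr
      · omega
    have h2 : (0 : ℝ) ≤ (bubbleLevels a b (k - 1)).ncard := Nat.cast_nonneg _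
    have h3 : 4 * N = 4 * (bubbleLevels a b (k - 1)).ncard + ((b : ℝ) - 1) ^ k * (2 * r) := by
      rw [hN, bubbleSize, ← hk]; ring
    linarith
  have h2R : 2 * R ≤ n := by
    refine Nat.le_floor ?_
    push_cast
    linarith
  have hcount := mul_pow_le_factorial (b := b) (by omega : 1 ≤ b) (by omega : 1 ≤ n) hY h2R
  have hfl : 8 * b * n ≤ ⌊D * N⌋₊ := by
    refine Nat.le_floor ?_
    have h1 : (n : ℝ) ≤ 4 * N := Nat.floor_le (by linarith)
    have h2 : (0 : ℝ) ≤ b := Nat.cast_nonneg b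
    have h3 : 0 ≤ N := by linarith
    push_cast
    have h4 : 8 * (b : ℝ) * n ≤ 8 * b * (4 * N) := by gcongr
    have h5 : (32 * (b : ℝ)) * N ≤ D * N := by gcongr; linarith
    linarith
  refine (hmain k R hk1 hR1 hRa v ?_).trans (ENNReal.ofReal_le_ofReal ?_)
  · refine le_trans ?_ hv
    exact_mod_cast hcount.trans (Nat.factorial_le hfl)
  · have hR0 : (0 : ℝ) < R := by exact_mod_cast hR1
    rw [div_le_div_iff₀ (by positivity) (by positivity)]
    have h1 : r ^ 2 ≤ 4 * R ^ 2 := by nlinarith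
    have h2 : K * r ^ 2 ≤ K * (4 * R ^ 2) := by gcongr
    have h3 : 4 * K ≤ D := by linarith [(Nat.cast_nonneg b : (0 : ℝ) ≤ b)]
    nlinarith [mul_le_mul_of_nonneg_right h3 (sq_nonneg (R : ℝ))]

/-- All bubbles below level `k(r)` have `a ≤ 2 r`, and the numbers of bubbles form a geometric
series of ratio `b - 1 ≥ 2`, dominated by `(b - 1) ^ k`. For `b = 2` the series is not geometric,
hence the separate statement in that case. -/
theorem bubbleSize_le (hb : 3 ≤ b) {r : ℝ} (hr : 0 < r) (ha : IsScalingSequence a) :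
    bubbleSize a b r ≤ 5 * (r * ((b : ℝ) - 1) ^ bubbleIndex a r) := by
  have hk1 := (bubbleIndex_spec ha r).1
  set k := bubbleIndex a r with hk
  set q : ℝ := (b : ℝ) - 1 with hq
  have hb1 : ((b - 1 : ℕ) : ℝ) = q := by
    rw [Nat.cast_sub (by omega)]; simp [hq]
  have hq2 : 2 ≤ q := by
    have : (3 : ℝ) ≤ b := by exact_mod_cast hb
    linarith
  have hgeom : ∀ m : ℕ, ∑ n ∈ Finset.range m, q ^ n ≤ q ^ m := by
    intro m
    induction m with
    | zero => simp
    | succ m ih =>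
      rw [Finset.sum_range_succ, pow_succ]
      have : 0 < q ^ m := by positivity
      nlinarith
  have h1 : ((bubbleLevels a b (k - 1)).ncard : ℝ) ≤ 4 * r * q ^ k := by
    calc ((bubbleLevels a b (k - 1)).ncard : ℝ)
        ≤ ((∑ n ∈ Finset.range (k - 1), (b - 1) ^ n * (2 * (a (n + 1) : ℕ)) : ℕ) : ℝ) := by
          exact_mod_cast ncard_bubbleLevels_le (k - 1)
      _ ≤ ∑ n ∈ Finset.range (k - 1), q ^ n * (4 * r) := by
          push_cast
          rw [hb1]
          refine Finset.sum_le_sum fun n hn => ?_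
          have := scaling_le_of_lt_bubbleIndex (a := a) (r := r) (j := n + 1) (by omega)
            (by rw [Finset.mem_range] at hn; omega)
          exact mul_le_mul_of_nonneg_left (by linarith) (by positivity)
      _ ≤ 4 * r * q ^ k := by
          rw [← Finset.sum_mul, mul_comm]
          gcongr
          exact (hgeom _).trans (pow_le_pow_right₀ (by linarith) (by omega))
  have h2 : 0 < r * q ^ k := by positivity
  unfold bubbleSize
  rw [← hk, ← hq]
  nlinarith

theorem bubbleSize_mul_le (hb : 3 ≤ b) (ha : IsScalingSequence a) {r ε : ℝ} (hr : 0 < r)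
    (hε : 0 < ε) (hε1 : ε ≤ 1) : bubbleSize a b (ε * r) ≤ 10 * ε * bubbleSize a b r := by
  have h1 := bubbleSize_le (a := a) hb (mul_pos hε hr) ha
  have h2 := (le_bubbleSize (a := a) (by omega : 2 ≤ b) hr.le).2.1
  have hq : (1 : ℝ) ≤ (b : ℝ) - 1 := by
    have : (3 : ℝ) ≤ b := by exact_mod_cast hb
    linarith
  have h3 : ((b : ℝ) - 1) ^ bubbleIndex a (ε * r) ≤ ((b : ℝ) - 1) ^ bubbleIndex a r :=
    pow_le_pow_right₀ hq (bubbleIndex_mono ha (mul_le_of_le_one_left hr.le hε1))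
  have h4 := mul_le_mul_of_nonneg_left h3 (mul_pos hε hr).le
  nlinarith

/-- Apply the previous bound at radius `ε r` with `ε = 1 / (10 D)`: since the size at `ε r` is at
most `10 ε` times the size at `r`, the factor `D` inside the factorial disappears. -/
theorem exists_profileTwo_le_factorial_bubbleSize (hb : 3 ≤ b) (ha : IsScalingSequence a)
    {φ : PMF (ZWreath (bubbleGroup a b))} (hφ : φ.support.Finite) :
    ∃ D : ℝ, 1 ≤ D ∧ ∀ r : ℝ, 1 < r → ∀ v : ℝ, ((⌊bubbleSize a b r⌋₊.factorial : ℕ) : ℝ) ≤ v →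
      profileTwo φ v ≤ ENNReal.ofReal (D / r ^ 2) := by
  obtain ⟨D, hD, h⟩ := exists_profileTwo_le (by omega : 2 ≤ b) ha hφ
  -- This equals `D / ε²`, and it also dominates `r²` when `ε r ≤ 1`, where the trivial bound 1 is
  -- used.
  refine ⟨100 * D ^ 3, by nlinarith [one_le_pow₀ hD (n := 3)], fun r hr v hv => ?_⟩
  set ε := (10 * D)⁻¹ with hε
  have hε0 : 0 < ε := by positivity
  have hε1 : ε ≤ 1 := inv_le_one_of_one_le₀ (by linarith)
  have hr2 : 0 < r ^ 2 := by positivity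
  rcases le_or_gt (ε * r) 1 with hle | hgt
  · have h1 : 1 ≤ v := le_trans (by exact_mod_cast Nat.factorial_pos _) hv
    refine (profileTwo_le_one φ h1).trans ?_
    rw [← ENNReal.ofReal_one]
    apply ENNReal.ofReal_le_ofReal
    rw [le_div_iff₀ hr2, one_mul]
    have h2 : r ≤ 10 * D := by
      rwa [hε, inv_mul_le_iff₀ (by positivity), mul_one] at hle
    calc r ^ 2 ≤ (10 * D) ^ 2 := by gcongr
      _ = 100 * D ^ 2 * 1 := by ring
      _ ≤ 100 * D ^ 2 * D := by gcongr
      _ = 100 * D ^ 3 := by ring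
  · refine (h (ε * r) hgt v (le_trans ?_ hv)).trans (ENNReal.ofReal_le_ofReal (le_of_eq ?_))
    · have h1 := bubbleSize_mul_le hb ha (by linarith : 0 < r) hε0 hε1
      have h2 : D * bubbleSize a b (ε * r) ≤ bubbleSize a b r := by
        calc D * bubbleSize a b (ε * r) ≤ D * (10 * ε * bubbleSize a b r) := by gcongr
          _ = bubbleSize a b r := by rw [hε]; field_simp
      exact_mod_cast Nat.factorial_le (Nat.floor_mono h2)
    · rw [hε]; field_simp; norm_num

/-! ### Balls of the bubble graph -/

theorem exists_walk_pow {σ : Equiv.Perm (BubbleVertex a b)}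
    (hσ : ∀ x, σ x = x ∨ (bubbleGraph a b).Adj x (σ x)) {x y : BubbleVertex a b} (n : ℕ)
    (h : (σ ^ n) x = y) : ∃ p : (bubbleGraph a b).Walk x y, p.length ≤ n := by
  subst h
  induction n with
  | zero => exact ⟨SimpleGraph.Walk.nil, le_rfl⟩
  | succ n ih =>
    obtain ⟨p, hp⟩ := ih
    rw [pow_succ', Equiv.Perm.mul_apply]
    rcases hσ ((σ ^ n) x) with h | h
    · rw [h]; exact ⟨p, by omega⟩
    · exact ⟨p.concat h, by rw [SimpleGraph.Walk.length_concat]; omega⟩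

theorem exists_walk_root_le (x : BubbleVertex a b) :
    ∃ p : (bubbleGraph a b).Walk (bubbleRoot a b) x,
      p.length ≤ ∑ n ∈ Finset.range (bubbleLevel x), (2 * (a (n + 1) : ℕ) + b) := by
  have hα : ∀ x, bubbleAlpha a b x = x ∨ (bubbleGraph a b).Adj x (bubbleAlpha a b x) := fun x => by
    rw [bubbleGraph, SimpleGraph.fromRel_adj]
    by_cases h : bubbleAlpha a b x = x
    · exact Or.inl h
    · exact Or.inr ⟨fun h' => h h'.symm, Or.inl (Or.inl rfl)⟩
  have hβ : ∀ x, bubbleBeta a b x = x ∨ (bubbleGraph a b).Adj x (bubbleBeta a b x) := fun x => by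
    rw [bubbleGraph, SimpleGraph.fromRel_adj]
    by_cases h : bubbleBeta a b x = x
    · exact Or.inl h
    · exact Or.inr ⟨fun h' => h h'.symm, Or.inl (Or.inr rfl)⟩
  have hst : ∀ w : BubbleWord b, ∃ p : (bubbleGraph a b).Walk (bubbleRoot a b) (bubbleStart a w),
      p.length ≤ ∑ n ∈ Finset.range w.length, (2 * (a (n + 1) : ℕ) + b) := by
    intro w
    induction w with
    | nil => exact ⟨SimpleGraph.Walk.nil, le_rfl⟩
    | cons z w ih =>
      obtain ⟨p, hp⟩ := ih
      have hend : (bubbleAlpha a b ^ (a (w.length + 1) : ℕ)) (bubbleStart a w) = bubbleEnd a w := by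
        rw [← zpow_natCast, bubbleAlpha_zpow_apply_start, Int.cast_natCast]
        rfl
      obtain ⟨p₁, hp₁⟩ := exists_walk_pow hα _ hend
      obtain ⟨p₂, hp₂⟩ := exists_walk_pow hβ _ (bubbleBeta_pow_succ_apply_end w z.1 z.2)
      refine ⟨(p.append p₁).append p₂, ?_⟩
      rw [SimpleGraph.Walk.length_append, SimpleGraph.Walk.length_append, List.length_cons,
        Finset.sum_range_succ]
      have := z.2
      omega
  obtain ⟨w, u⟩ := x
  obtain ⟨p, hp⟩ := hst w
  have : NeZero (2 * (a (w.length + 1) : ℕ)) := ⟨by positivity⟩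
  have hu : (bubbleAlpha a b ^ u.val) (bubbleStart a w) = ⟨w, u⟩ := by
    rw [← zpow_natCast, bubbleAlpha_zpow_apply_start, Int.cast_natCast, ZMod.natCast_zmod_val]
  obtain ⟨p₁, hp₁⟩ := exists_walk_pow hα _ hu
  refine ⟨p.append p₁, ?_⟩
  change _ ≤ ∑ n ∈ Finset.range (w.length + 1), (2 * (a (n + 1) : ℕ) + b)
  rw [SimpleGraph.Walk.length_append, Finset.sum_range_succ]
  have := ZMod.val_lt u
  omega

theorem length_beta_le (x : BubbleVertex a b) :
    (bubbleBeta a b x).1.length ≤ x.1.length + 1 ∧ x.1.length ≤ (bubbleBeta a b x).1.length + 1 := by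
  have hcyc : ∀ {w : BubbleWord b} {y : BubbleVertex a b}, y ∈ bubbleCycle a w →
      w.length ≤ y.1.length ∧ y.1.length ≤ w.length + 1 := by
    rintro w y (rfl | ⟨z, rfl⟩)
    · exact ⟨le_rfl, Nat.le_succ _⟩
    · exact ⟨Nat.le_succ _, le_rfl⟩
  by_cases h : ∃ w, x ∈ bubbleCycle a w
  · obtain ⟨w, hw⟩ := h
    have h1 := hcyc hw
    have h2 := hcyc (bubbleBeta_apply_mem hw)
    omega
  · push Not at h
    rw [bubbleBeta_apply_eq_self h]
    omega

theorem length_le_of_walk {x y : BubbleVertex a b} (p : (bubbleGraph a b).Walk x y) :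
    y.1.length ≤ x.1.length + p.length := by
  induction p with
  | nil => simp
  | @cons x z y h p ih =>
    rw [SimpleGraph.Walk.length_cons]
    have hz : z.1.length ≤ x.1.length + 1 := by
      rw [bubbleGraph, SimpleGraph.fromRel_adj] at h
      rcases h.2 with (h | h) | (h | h)
      · rw [h]; exact Nat.le_succ _
      · rw [h]; exact (length_beta_le x).1
      · rw [h]; exact Nat.le_succ _
      · rw [h]; exact (length_beta_le z).2
    omega

/-- Each edge raises the level by at most one. Finiteness is what lets `ncard` of the ball be
bounded below by that of a subset. -/
theorem bubbleBall_finite (r : ℝ) : (bubbleBall a b r).Finite := by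
  refine (bubbleLevels_finite (⌊r⌋₊ + 1)).subset ?_
  rintro x ⟨p, hp⟩
  have h1 : x.1.length ≤ 0 + p.length := length_le_of_walk p
  have h2 := Nat.le_floor hp
  simp only [bubbleLevels, bubbleLevel, Set.mem_ofPred_eq]
  omega

theorem bubbleLevels_subset_bubbleBall {m : ℕ} {r : ℝ}
    (h : ((∑ n ∈ Finset.range m, (2 * (a (n + 1) : ℕ) + b) : ℕ) : ℝ) ≤ r) :
    bubbleLevels a b m ⊆ bubbleBall a b r := by
  intro x hx
  obtain ⟨p, hp⟩ := exists_walk_root_le x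
  refine ⟨p, le_trans ?_ h⟩
  have h1 : bubbleLevel x ≤ m := hx
  have h2 := Finset.sum_le_sum_of_subset (f := fun n => 2 * (a (n + 1) : ℕ) + b)
    (Finset.range_mono h1)
  exact_mod_cast hp.trans h2

end Bounds

section Exponential

variable {s : ℝ} {a : ℕ → ℕ+}

/-! ### Exponential scaling sequences -/

theorem half_le_floor {t : ℝ} (ht : 1 ≤ t) : t / 2 ≤ ⌊t⌋₊ := by
  have h1 := Nat.lt_floor_add_one t
  have h2 : (1 : ℝ) ≤ ⌊t⌋₊ := by exact_mod_cast (Nat.one_le_floor_iff t).2 ht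
  linarith

theorem isScalingSequence_exp (hs : 0 < s) (ha : ∀ k : ℕ, 1 ≤ k → (a k : ℕ) = ⌊(2 : ℝ) ^ (s * k)⌋₊) :
    IsScalingSequence a where
  mono j k hj hjk := by
    rw [← PNat.coe_le_coe, ha j hj, ha k (hj.trans hjk)]
    refine Nat.floor_mono (Real.rpow_le_rpow_of_exponent_le one_le_two ?_)
    have : (j : ℝ) ≤ k := by exact_mod_cast hjk
    gcongr
  tendsto := by
    have h1 : Filter.Tendsto (fun k : ℕ => ⌊((2 : ℝ) ^ s) ^ k⌋₊) Filter.atTop Filter.atTop :=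
      tendsto_nat_floor_atTop.comp
        (tendsto_pow_atTop_atTop_of_one_lt (Real.one_lt_rpow one_lt_two hs))
    refine h1.congr' ?_
    filter_upwards [Filter.eventually_ge_atTop 1] with k hk
    rw [ha k hk, Real.rpow_mul zero_le_two, Real.rpow_natCast]

theorem two_pow_eq_rpow (hs : 0 < s) (k : ℕ) : (2 : ℝ) ^ k = ((2 : ℝ) ^ (s * k)) ^ (1 / s) := by
  rw [← Real.rpow_mul zero_le_two, ← Real.rpow_natCast]
  congr 1
  field_simp

/-- By minimality of `k = k(r)`, `2 ^ (s (k - 1)) < 2 r + 1 ≤ 3 r` when `k > 1`, so `2 ^ k` is of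
order at most `r ^ (1 / s)`. -/
theorem exists_bubbleSize_le_rpow (hs : 0 < s)
    (ha : ∀ k : ℕ, 1 ≤ k → (a k : ℕ) = ⌊(2 : ℝ) ^ (s * k)⌋₊) :
    ∃ A : ℝ, 1 ≤ A ∧ ∀ r : ℝ, 1 < r → bubbleSize a 3 r ≤ A * r ^ (1 + 1 / s) := by
  have hsc := isScalingSequence_exp hs ha
  have h3 : (1 : ℝ) ≤ 3 ^ (1 / s) := Real.one_le_rpow (by norm_num) (by positivity)
  refine ⟨10 * 3 ^ (1 / s), by linarith, fun r hr => ?_⟩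
  have hr0 : 0 < r := by linarith
  have h1 := bubbleSize_le (b := 3) le_rfl hr0 hsc
  have hk1 := (bubbleIndex_spec hsc r).1
  set k := bubbleIndex a r with hk
  have h2 : (2 : ℝ) ^ (k - 1) ≤ (3 * r) ^ (1 / s) := by
    rcases hk1.eq_or_lt with h | h
    · rw [← h, Nat.sub_self, pow_zero]
      exact Real.one_le_rpow (by linarith) (by positivity)
    · rw [two_pow_eq_rpow hs]
      refine Real.rpow_le_rpow (by positivity) ?_ (by positivity)
      have h4 := scaling_le_of_lt_bubbleIndex (a := a) (r := r) (j := k - 1) (by omega) (by omega)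
      rw [ha (k - 1) (by omega)] at h4
      have h5 := Nat.lt_floor_add_one ((2 : ℝ) ^ (s * ((k - 1 : ℕ) : ℝ)))
      linarith
  have h6 : (2 : ℝ) ^ k = 2 * 2 ^ (k - 1) := by
    rw [← pow_succ', Nat.sub_add_cancel hk1]
  calc bubbleSize a 3 r ≤ 5 * (r * (((3 : ℕ) : ℝ) - 1) ^ k) := h1
    _ = 10 * (r * 2 ^ (k - 1)) := by
        rw [show ((3 : ℕ) : ℝ) - 1 = 2 by norm_num, h6]; ring
    _ ≤ 10 * (r * (3 * r) ^ (1 / s)) := by gcongr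
    _ = 10 * 3 ^ (1 / s) * r ^ (1 + 1 / s) := by
        rw [Real.mul_rpow (by norm_num) hr0.le, Real.rpow_add hr0, Real.rpow_one]; ring

/-- Since the bubble lengths grow geometrically, all levels up to `m` lie within distance of order
`2 ^ (s m)` of the root, and the last of them alone has about `2 ^ m · 2 ^ (s m)` vertices. -/
theorem exists_rpow_le_ncard_bubbleBall (hs : 0 < s)
    (ha : ∀ k : ℕ, 1 ≤ k → (a k : ℕ) = ⌊(2 : ℝ) ^ (s * k)⌋₊) :
    ∃ B r₀ : ℝ, 0 < B ∧ ∀ r : ℝ, r₀ ≤ r →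
      B * r ^ (1 + 1 / s) ≤ ((bubbleBall a 3 r).ncard : ℝ) := by
  set q : ℝ := (2 : ℝ) ^ s with hq
  have hq1 : 1 < q := Real.one_lt_rpow one_lt_two hs
  have hq0 : 0 < q - 1 := by linarith
  -- At most `2 q ^ j + 3 ≤ 5 q ^ j` steps are spent at level `j`; `q / (q - 1)` sums the geometric
  -- series.
  set E : ℝ := 5 * (q / (q - 1)) with hE
  have hE0 : 0 < E := by positivity
  have haq : ∀ k : ℕ, (2 : ℝ) ^ (s * k) = q ^ k := fun k => by
    rw [Real.rpow_mul zero_le_two, Real.rpow_natCast]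
  have hsum : ∀ m : ℕ, ∑ n ∈ Finset.range m, 5 * q ^ (n + 1) ≤ E * q ^ m := by
    intro m
    induction m with
    | zero => simp [hE0.le]
    | succ m ih =>
      rw [Finset.sum_range_succ]
      refine (add_le_add_left ih _).trans (le_of_eq ?_)
      rw [hE]
      field_simp
      ring
  refine ⟨2⁻¹ * (E * q)⁻¹ ^ (1 + 1 / s), E * q, by positivity, fun r hr => ?_⟩
  have hr0 : 0 < r := lt_of_lt_of_le (by positivity) hr
  have hrE : q ≤ r / E := by rw [le_div_iff₀ hE0]; linarith
  obtain ⟨m, hm1, hm2⟩ := exists_nat_pow_near (hq1.le.trans hrE) hq1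
  have hm0 : m ≠ 0 := by
    rintro rfl
    rw [zero_add, pow_one] at hm2
    linarith
  obtain ⟨n, rfl⟩ := Nat.exists_eq_succ_of_ne_zero hm0
  have hsub : bubbleLevels a 3 (n + 1) ⊆ bubbleBall a 3 r := by
    refine bubbleLevels_subset_bubbleBall ?_
    push_cast
    have hterm : ∀ j ∈ Finset.range (n + 1), 2 * ((a (j + 1) : ℕ) : ℝ) + 3 ≤ 5 * q ^ (j + 1) := by
      intro j _
      rw [ha (j + 1) (by omega), haq]
      have h1 : (1 : ℝ) ≤ q ^ (j + 1) := one_le_pow₀ hq1.le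
      have h2 := Nat.floor_le (by linarith : 0 ≤ q ^ (j + 1))
      linarith
    refine (Finset.sum_le_sum hterm).trans ((hsum _).trans ?_)
    rw [le_div_iff₀ hE0, mul_comm] at hm1
    exact hm1
  have hcard : 2 ^ n * (2 * (a (n + 1) : ℕ)) ≤ (bubbleBall a 3 r).ncard :=
    (le_ncard_bubbleLevels (a := a) (b := 3) n).trans (Set.ncard_le_ncard hsub (bubbleBall_finite r))
  have hcard' : (2 : ℝ) ^ n * (2 * (a (n + 1) : ℕ)) ≤ ((bubbleBall a 3 r).ncard : ℝ) := by
    exact_mod_cast hcard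
  refine le_trans ?_ hcard'
  have hlow : r / (E * q) ≤ q ^ (n + 1) := by
    rw [div_le_iff₀ (by positivity)]
    rw [div_lt_iff₀ hE0, pow_succ] at hm2
    linarith
  calc 2⁻¹ * (E * q)⁻¹ ^ (1 + 1 / s) * r ^ (1 + 1 / s)
      = 2⁻¹ * (r / (E * q)) ^ (1 + 1 / s) := by
        rw [div_eq_inv_mul r, Real.mul_rpow (by positivity) hr0.le, mul_assoc]
    _ ≤ 2⁻¹ * (q ^ (n + 1)) ^ (1 + 1 / s) := by gcongr
    _ = 2⁻¹ * (q ^ (n + 1) * 2 ^ (n + 1)) := by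
        rw [Real.rpow_add (by positivity), Real.rpow_one, two_pow_eq_rpow hs, haq]
    _ = 2 ^ n * (2 * (q ^ (n + 1) / 2)) := by rw [pow_succ (2 : ℝ)]; ring
    _ ≤ 2 ^ n * (2 * (a (n + 1) : ℕ)) := by
        gcongr
        rw [ha (n + 1) (by omega), haq]
        exact half_le_floor (one_le_pow₀ hq1.le)

/-- The asymptotic facts on `log v` and `log log v` used below. -/
theorem eventually_logLog (Y L₀ : ℝ) : ∀ᶠ v : ℝ in Filter.atTop, 0 < v ∧ L₀ ≤ Real.log v ∧
    1 ≤ Real.log (Real.log v) ∧ 2 * Real.log (Real.log (Real.log v)) ≤ Real.log (Real.log v) ∧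
    Y ≤ Real.log v / Real.log (Real.log v) := by
  have hlo : ∀ c : ℝ, 0 < c → ∀ᶠ x : ℝ in Filter.atTop, Real.log x ≤ c * x := by
    intro c hc
    filter_upwards [Real.isLittleO_log_id_atTop.bound hc, Filter.eventually_ge_atTop 0] with x hx hx0
    have := (le_abs_self _).trans hx
    simpa [abs_of_nonneg hx0] using this
  have h1 := Real.tendsto_log_atTop
  have h2 := h1.comp h1
  filter_upwards [Filter.eventually_gt_atTop 0, h1.eventually_ge_atTop L₀, h2.eventually_ge_atTop 1,
    h2.eventually (hlo (1 / 2) (by norm_num)),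
    h1.eventually (hlo (|Y| + 1)⁻¹ (by positivity))] with v hv0 hv1 hv2 hv3 hv4
  simp only [Function.comp_apply] at hv2 hv3
  refine ⟨hv0, hv1, hv2, by linarith, ?_⟩
  rw [le_div_iff₀ (by linarith)]
  have h3 : (|Y| + 1) * Real.log (Real.log v) ≤ Real.log v := by
    rwa [← le_inv_mul_iff₀ (by positivity)]
  nlinarith [le_abs_self Y]

theorem logLogRate_eq (hs : 0 < s) {v : ℝ} (h : 0 < Real.log v / Real.log (Real.log v)) {κ r : ℝ}
    (hr : r = κ * (Real.log v / Real.log (Real.log v)) ^ (1 + 1 / s)⁻¹) (hκ : 0 < κ) :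
    logLogRate s v = κ ^ 2 / r ^ 2 := by
  set y := Real.log v / Real.log (Real.log v) with hy
  have h1 : Real.log (Real.log v) / Real.log v = y⁻¹ := by rw [hy, inv_div]
  have h2 : (y ^ (1 + 1 / s)⁻¹) ^ 2 = y ^ (2 * s / (s + 1)) := by
    rw [← Real.rpow_natCast, ← Real.rpow_mul h.le]
    congr 1
    push_cast
    field_simp
  rw [logLogRate, h1, hr, mul_pow, h2, Real.inv_rpow h.le]
  have : 0 < y ^ (2 * s / (s + 1)) := Real.rpow_pos_of_pos h _
  field_simp

theorem exists_profileOne_ge_logLogRate (hs : 0 < s)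
    (ha : ∀ k : ℕ, 1 ≤ k → (a k : ℕ) = ⌊(2 : ℝ) ^ (s * k)⌋₊)
    {φ : PMF (ZWreath (bubbleGroup a 3))} (hφ : IsSymmetricGenerating φ) :
    ∃ c : ℝ, 0 < c ∧ ∀ᶠ v : ℝ in Filter.atTop,
      ENNReal.ofReal (c * logLogRate s v) ≤ profileOne φ v ^ 2 := by
  obtain ⟨C, hC4, hC⟩ := exists_le_profileOne φ hφ
  obtain ⟨B, r₀, hB, hball⟩ := exists_rpow_le_ncard_bubbleBall hs ha
  set p := 1 + 1 / s with hp
  have hp0 : 0 < p := by positivity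
  have hC0 : 0 < C := by linarith
  -- The ratio `4 p C / B` makes the logarithm of the volume threshold at least `2 log v`; the
  -- maximum with 1 gives `κ ≥ 1`.
  set t := max 1 (4 * p * C / B) with ht
  have ht0 : 0 < t := lt_of_lt_of_le one_pos (le_max_left _ _)
  set κ := t ^ p⁻¹ with hκ
  have hκ1 : 1 ≤ κ := Real.one_le_rpow (le_max_left _ _) (by positivity)
  have hκp : κ ^ p = t := by rw [hκ, ← Real.rpow_mul ht0.le, inv_mul_cancel₀ hp0.ne', Real.rpow_one]
  refine ⟨(C ^ 2 * κ ^ 2)⁻¹, by positivity, ?_⟩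
  filter_upwards [eventually_logLog (max 2 (|r₀| + 1) ^ p) (Real.log C)] with v hv
  obtain ⟨hv0, hLC, hM1, hMM, hY⟩ := hv
  set L := Real.log v with hL
  set M := Real.log L with hM
  set y := L / M with hy
  have hbase : (0 : ℝ) < max 2 (|r₀| + 1) := lt_of_lt_of_le two_pos (le_max_left _ _)
  have hy0 : 0 < y := lt_of_lt_of_le (Real.rpow_pos_of_pos hbase _) hY
  have hroot : max 2 (|r₀| + 1) ≤ y ^ p⁻¹ := by
    have := Real.rpow_le_rpow (by positivity) hY (inv_nonneg.2 hp0.le)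
    rwa [← Real.rpow_mul hbase.le, mul_inv_cancel₀ hp0.ne', Real.rpow_one] at this
  set r := κ * y ^ p⁻¹ with hr
  have hyr : y ^ p⁻¹ ≤ r := le_mul_of_one_le_left (by positivity) hκ1
  have hr1 : 1 < r := by linarith [le_max_left 2 (|r₀| + 1)]
  have hr0 : r₀ ≤ r := by linarith [le_max_right 2 (|r₀| + 1), le_abs_self r₀]
  have hL0 : 0 < L := by
    have : 0 < y * M := by positivity
    rwa [hy, div_mul_cancel₀ L (by linarith : M ≠ 0)] at this
  have hrp : r ^ p = t * y := by
    rw [hr, Real.mul_rpow (by positivity) (by positivity), hκp, ← Real.rpow_mul hy0.le,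
      inv_mul_cancel₀ hp0.ne', Real.rpow_one]
  -- Since `log y = M - log M ≥ M / 2`, the radius has `log r` comparable to `log log v`.
  have hlogr : M / (2 * p) ≤ Real.log r := by
    rw [hr, Real.log_mul (by positivity) (by positivity), Real.log_rpow hy0, hy,
      Real.log_div hL0.ne' (by linarith), ← hM]
    have h1 : 0 ≤ Real.log κ := Real.log_nonneg hκ1
    have h2 : M / (2 * p) = p⁻¹ * (M / 2) := by field_simp
    rw [h2]
    have h3 : p⁻¹ * (M / 2) ≤ p⁻¹ * (M - Real.log M) := by gcongr; linarith
    linarith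
  have hprof := hC r hr1 v (by
    -- One of the two copies of `L` absorbs `log C ≤ L`, that is, the prefactor `C⁻¹`.
    have hexp : 2 * L ≤ Real.log r * (((bubbleBall a 3 r).ncard : ℝ) / C) := by
      have h1 : B * (t * y) / C ≤ ((bubbleBall a 3 r).ncard : ℝ) / C := by
        rw [← hrp]; gcongr; exact hball r hr0
      have h2 : M / (2 * p) * (B * (t * y) / C) ≤
          Real.log r * (((bubbleBall a 3 r).ncard : ℝ) / C) := by
        gcongr
        exact Real.log_nonneg hr1.le
      refine le_trans ?_ h2
      have h3 : 4 * p * C ≤ B * t := by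
        have : 4 * p * C / B ≤ t := le_max_right _ _
        rw [div_le_iff₀ hB] at this
        linarith
      have h4 : M / (2 * p) * (B * (t * y) / C) = (B * t) * L / (2 * p * C) := by
        rw [hy]; field_simp
      rw [h4, le_div_iff₀ (by positivity)]
      nlinarith
    rw [Real.rpow_def_of_pos (by linarith), ← Real.exp_log hv0, ← Real.exp_log (inv_pos.2 hC0),
      ← Real.exp_add, Real.log_inv]
    apply Real.exp_le_exp.2
    linarith)
  rw [logLogRate_eq hs hy0 hr (by positivity)]
  calc ENNReal.ofReal ((C ^ 2 * κ ^ 2)⁻¹ * (κ ^ 2 / r ^ 2))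
      = ENNReal.ofReal (1 / (C * r)) ^ 2 := by
        rw [← ENNReal.ofReal_pow (by positivity)]
        congr 1
        field_simp
    _ ≤ profileOne φ v ^ 2 := by gcongr

theorem exists_profileTwo_le_logLogRate (hs : 0 < s)
    (ha : ∀ k : ℕ, 1 ≤ k → (a k : ℕ) = ⌊(2 : ℝ) ^ (s * k)⌋₊)
    {φ : PMF (ZWreath (bubbleGroup a 3))} (hφ : φ.support.Finite) :
    ∃ c : ℝ, 0 < c ∧ ∀ᶠ v : ℝ in Filter.atTop,
      profileTwo φ v ≤ ENNReal.ofReal (c * logLogRate s v) := by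
  obtain ⟨D, hD1, hD⟩ :=
    exists_profileTwo_le_factorial_bubbleSize le_rfl (isScalingSequence_exp hs ha) hφ
  obtain ⟨A, hA1, hA⟩ := exists_bubbleSize_le_rpow hs ha
  set p := 1 + 1 / s with hp
  have hp0 : 0 < p := by positivity
  have hA0 : 0 < A := by linarith
  -- Chosen so that `A r ^ p = y` exactly; then the size at `r` is at most `y`, and `y ^ y ≤ exp (y
  -- log log v) = v`.
  set κ := A⁻¹ ^ p⁻¹ with hκ
  have hκ0 : 0 < κ := Real.rpow_pos_of_pos (inv_pos.2 hA0) _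
  have hκp : κ ^ p = A⁻¹ := by
    rw [hκ, ← Real.rpow_mul (inv_pos.2 hA0).le, inv_mul_cancel₀ hp0.ne', Real.rpow_one]
  refine ⟨D / κ ^ 2, by positivity, ?_⟩
  filter_upwards [eventually_logLog (max 1 ((2 / κ) ^ p)) 0] with v hv
  obtain ⟨hv0, hL0, hM1, -, hY⟩ := hv
  set L := Real.log v with hL
  set M := Real.log L with hM
  set y := L / M with hy
  have hy1 : 1 ≤ y := (le_max_left _ _).trans hY
  have hy0 : 0 < y := by linarith
  have hroot : 2 / κ ≤ y ^ p⁻¹ := by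
    have := Real.rpow_le_rpow (by positivity) ((le_max_right _ _).trans hY) (inv_nonneg.2 hp0.le)
    rwa [← Real.rpow_mul (by positivity), mul_inv_cancel₀ hp0.ne', Real.rpow_one] at this
  set r := κ * y ^ p⁻¹ with hr
  have hr1 : 1 < r := by
    rw [div_le_iff₀ hκ0] at hroot
    linarith
  have hrp : A * r ^ p = y := by
    rw [hr, Real.mul_rpow (by positivity) (by positivity), hκp, ← Real.rpow_mul hy0.le,
      inv_mul_cancel₀ hp0.ne', Real.rpow_one, mul_inv_cancel_left₀ hA0.ne']
  have hLy : y ≤ L := div_le_self hL0 hM1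
  have hfact : ((⌊bubbleSize a 3 r⌋₊.factorial : ℕ) : ℝ) ≤ v := by
    set n := ⌊bubbleSize a 3 r⌋₊ with hn
    have hny : (n : ℝ) ≤ y := by
      rw [← hrp]
      refine (Nat.floor_le ?_).trans (hA r hr1)
      linarith [(le_bubbleSize (a := a) (b := 3) (by norm_num) (by linarith : 0 ≤ r)).2.2]
    calc ((n.factorial : ℕ) : ℝ) ≤ (n : ℝ) ^ n := by exact_mod_cast Nat.factorial_le_pow n
      _ ≤ y ^ n := by gcongr
      _ = y ^ (n : ℝ) := (Real.rpow_natCast _ _).symm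
      _ ≤ y ^ y := Real.rpow_le_rpow_of_exponent_le hy1 hny
      _ = Real.exp (Real.log y * y) := Real.rpow_def_of_pos hy0 _
      _ ≤ Real.exp (M * y) := by
          gcongr
          exact Real.log_le_log hy0 hLy
      _ = v := by
          rw [hy, mul_div_cancel₀ L (by linarith : M ≠ 0), hL, Real.exp_log hv0]
  refine (hD r hr1 v hfact).trans (le_of_eq ?_)
  rw [logLogRate_eq hs hy0 hr hκ0]
  congr 1
  field_simp

end Exponential

/-! ### Assembly of the bounds. -/

theorem theorem5p1 :
    (∀ (b : ℕ) (a : ℕ → ℕ+), 2 ≤ b → IsScalingSequence a →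
      ∀ φ : PMF (ZWreath (bubbleGroup a b)), IsSymmetricGenerating φ →
        ∃ C : ℝ, 0 < C ∧ ∀ r : ℝ, 1 < r →
          (∀ v : ℝ, v ≤ C⁻¹ * r ^ (((bubbleBall a b r).ncard : ℝ) / C) →
            ENNReal.ofReal (1 / (C * r)) ≤ profileOne φ v) ∧
          (3 ≤ b → ∀ v : ℝ, C * (Nat.factorial ⌊bubbleSize a b r⌋₊ : ℝ) ≤ v →
            profileTwo φ v ≤ ENNReal.ofReal (C / r ^ 2)) ∧
          (b = 2 → ∀ v : ℝ, C * (Nat.factorial ⌊C * bubbleSize a b r⌋₊ : ℝ) ≤ v →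
            profileTwo φ v ≤ ENNReal.ofReal (C / r ^ 2))) ∧
    (∀ (s : ℝ) (a : ℕ → ℕ+), 0 < s → (∀ k : ℕ, 1 ≤ k → (a k : ℕ) = ⌊(2 : ℝ) ^ (s * k)⌋₊) →
      ∀ φ : PMF (ZWreath (bubbleGroup a 3)), IsSymmetricGenerating φ →
        ∃ C v₀ : ℝ, 0 < C ∧ ∀ v : ℝ, v₀ ≤ v →
          ENNReal.ofReal (C⁻¹ * logLogRate s v) ≤ profileOne φ v ^ 2 ∧
          profileOne φ v ^ 2 ≤ ENNReal.ofReal (C * logLogRate s v) ∧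
          ENNReal.ofReal (C⁻¹ * logLogRate s v) ≤ profileTwo φ v ∧
          profileTwo φ v ≤ ENNReal.ofReal (C * logLogRate s v)) := by
  refine ⟨fun b a hb ha φ hφ => ?_, fun s a hs ha φ hφ => ?_⟩
  · obtain ⟨C₁, hC₁, h₁⟩ := exists_le_profileOne φ hφ
    obtain ⟨D, hD, h₂⟩ := exists_profileTwo_le hb ha hφ.finite_support
    obtain ⟨D', hD', h₃⟩ : ∃ D' : ℝ, 1 ≤ D' ∧ (3 ≤ b → ∀ r : ℝ, 1 < r → ∀ v : ℝ,
        ((⌊bubbleSize a b r⌋₊.factorial : ℕ) : ℝ) ≤ v →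
          profileTwo φ v ≤ ENNReal.ofReal (D' / r ^ 2)) := by
      by_cases h3 : 3 ≤ b
      · obtain ⟨D', hD', h⟩ := exists_profileTwo_le_factorial_bubbleSize h3 ha hφ.finite_support
        exact ⟨D', hD', fun _ => h⟩
      · exact ⟨1, le_rfl, fun h => absurd h h3⟩
    set C := C₁ + D + D' with hC
    have hC1 : 1 ≤ C := by linarith
    have hC0 : 0 < C := by linarith
    have hmul : ∀ (n : ℕ) (v : ℝ), C * (n.factorial : ℝ) ≤ v → (n.factorial : ℝ) ≤ v :=
      fun n v h => (le_mul_of_one_le_left (Nat.cast_nonneg _) hC1).trans h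
    refine ⟨C, hC0, fun r hr => ⟨fun v hv => ?_, fun h3 v hv => ?_, fun _ v hv => ?_⟩⟩
    · have hr0 : 0 < r := by linarith
      refine le_trans (ENNReal.ofReal_le_ofReal ?_) (h₁ r hr v (hv.trans ?_))
      · apply one_div_le_one_div_of_le
        · have : 0 < C₁ := by linarith
          positivity
        · gcongr
          linarith
      · gcongr
        · linarith
        · exact hr.le
        · linarith
    · refine (h₃ h3 r hr v (hmul _ _ hv)).trans (ENNReal.ofReal_le_ofReal ?_)
      gcongr
      linarith
    · refine (h₂ r hr v (le_trans ?_ (hmul _ _ hv))).trans (ENNReal.ofReal_le_ofReal ?_)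
      · have hN : 0 ≤ bubbleSize a b r := by
          linarith [(le_bubbleSize (a := a) hb (by linarith : 0 ≤ r)).2.2]
        have : D * bubbleSize a b r ≤ C * bubbleSize a b r := by gcongr; linarith
        exact_mod_cast Nat.factorial_le (Nat.floor_mono this)
      · gcongr
        linarith
  · obtain ⟨c, hc, h₁⟩ := exists_profileOne_ge_logLogRate hs ha hφ
    obtain ⟨d, hd, h₂⟩ := exists_profileTwo_le_logLogRate hs ha hφ.finite_support
    obtain ⟨v₀, hv₀⟩ := Filter.eventually_atTop.1
      ((h₁.and h₂).and (eventually_logLog 1 1))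
    -- The factors 2 compensate the one in Cheeger's inequality, once for each transferred bound.
    refine ⟨2 / c + 2 * d, v₀, by positivity, fun v hv => ?_⟩
    obtain ⟨⟨h₁, h₂⟩, -, hL, hM, -, -⟩ := hv₀ v hv
    have hrate : 0 ≤ logLogRate s v :=
      Real.rpow_nonneg (div_nonneg (by linarith) (by linarith)) _
    set C := 2 / c + 2 * d with hC
    have hC0 : 0 < C := by positivity
    have hCc : 2 * C⁻¹ ≤ c := by
      rw [← div_eq_mul_inv, div_le_iff₀ hC0, hC]
      have : c * (2 / c + 2 * d) = 2 + 2 * c * d := by field_simp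
      rw [this]
      nlinarith [mul_pos hc hd]
    have hCd : 2 * d ≤ C := by
      have : 0 < 2 / c := by positivity
      linarith
    have hcheeger := profileOne_sq_le φ v
    have hlow : ENNReal.ofReal (2 * (C⁻¹ * logLogRate s v)) ≤ profileOne φ v ^ 2 := by
      refine le_trans (ENNReal.ofReal_le_ofReal ?_) h₁
      rw [← mul_assoc]
      gcongr
    have htwo : ∀ x : ℝ, ENNReal.ofReal (2 * x) = 2 * ENNReal.ofReal x := fun x => by
      rw [ENNReal.ofReal_mul zero_le_two, ENNReal.ofReal_ofNat]
    refine ⟨le_trans (ENNReal.ofReal_le_ofReal ?_) hlow, ?_, ?_, ?_⟩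
    · have : 0 ≤ C⁻¹ * logLogRate s v := by positivity
      linarith
    · refine hcheeger.trans ((mul_le_mul_right h₂ 2).trans ?_)
      rw [← htwo, ← mul_assoc]
      gcongr
    · rw [htwo] at hlow
      exact (ENNReal.mul_le_mul_iff_right two_ne_zero ENNReal.ofNat_ne_top).1 (hlow.trans hcheeger)
    · refine h₂.trans (ENNReal.ofReal_le_ofReal ?_)
      gcongr
      linarith
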